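/- Let $G$ be a (real, finite-dimensional) semisimple Lie group with Lie algebra $\mathfrak g$ and $P\subset G$ a parabolic subgroup with Lie algebra $\mathfrak p$; that is, there are an element $E\in\mathfrak p$ (the grading element) and $k\ge 0$ with $\mathfrak g=\mathfrak g_{-k}\oplus\dots\oplus\mathfrak g_k$, $\mathfrak g_n=\{X:[E,X]=nX\}$, the subalgebra $\mathfrak g_{-k}\oplus\dots\oplus\mathfrak g_{-1}$ is generated by $\mathfrak g_{-1}$, $\mathfrak p=\mathfrak g_0\oplus\dots\oplus\mathfrak g_k$, and $P$ is a closed subgroup with Lie algebra $\mathfrak p$ such that $\mathrm{Ad}(P)$ preserves the filtration $\mathfrak g^\ell=\bigoplus_{n\ge \ell}\mathfrak g_n$. Let $K$ be a Lie group with Lie algebra $\mathfrak k$ and $H\subset K$ a closed subgroup with Lie algebra $\mathfrak h$. Let $(\alpha,i)$ be an extension of $(K,H)$ to $(G,P)$: $i:H\to P$ is an injective homomorphism of Lie groups and $\alpha:\mathfrak k\to\mathfrak g$ is a linear map with $\alpha\circ\mathrm{Ad}(h)=\mathrm{Ad}(i(h))\circ\alpha$ for $h\in H$ and $\alpha|_{\mathfrak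 h}=di$, inducing an isomorphism $\mathfrak k/\mathfrak h\to\mathfrak g/\mathfrak p$. Let $\lambda$ be a smooth representation of $P$ on a finite-dimensional real vector space $V$. Let $\mathcal V=K\times_{\lambda\circ i(H)}V\to K/H$. Its sections are identified with the smooth maps $s:K\to V$ satisfying $s(kh)=\lambda(i(h))^{-1}s(k)$ for $h\in H$; likewise, as $T(K/H)=K\times_{\mathrm{Ad}(H)}\mathfrak k/\mathfrak h$, the sections of $T^*(K/H)\otimes\mathcal V$ are the smooth $H$-equivariant maps from $K$ to the linear maps $\mathfrak k\to V$ vanishing on $\mathfrak h$. The group $K$ acts on sections by $(g\cdot s)(k)=s(g^{-1}k)$. A linear connection is a linear map $\nabla:\Gamma(\mathcal V)\to\Gamma(T^*(K/H)\otimes\mathcal V)$ with $\nabla(fs)=df\otimes s+f\nabla s$ for $f\in C^\infty(K/H)$; it is $K$-invariant if it commutes with the action of $K$. Let $D^{\mathfrak k}$ be the fundamental derivative: $(D^{\mathfrak k}s)(k)(X)$ is the derivative of $s$ at $k$ along the left-invariant vector field on $K$ generated by $X\in\mathfrak k$. A linear map $\Phi:\mathfrak k\to\mathfrak{gl}(V)$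 is $H$-equivariant if $\Phi(\mathrm{Ad}(h)X)=\lambda(i(h))\,\Phi(X)\,\lambda(i(h))^{-1}$ for all $h\in H$, $X\in\mathfrak k$. Then: 1. $\Phi\mapsto\nabla^\Phi:=D^{\mathfrak k}+\Phi$, i.e. $(\nabla^\Phi s)(k)(X)=(D^{\mathfrak k}s)(k)(X)+\Phi(X)(s(k))$, is a bijection from the set of $H$-equivariant linear maps $\Phi:\mathfrak k\to\mathfrak{gl}(V)$ with $\Phi(Y)=d\lambda(\alpha(Y))$ for all $Y\in\mathfrak h$ onto the set of $K$-invariant linear connections on $\mathcal V$. 2. Suppose that $d\lambda(E)$ is diagonalizable over $\mathbb R$, with eigenspaces $V_j$ ($j\in\mathbb R$), and let $V^\ell=\bigoplus_{j\ge\ell}V_j$ for $\ell\in\mathbb R$. Let $\mathfrak{gl}(V)^0$ be the sum of the eigenspaces of $A\mapsto[d\lambda(E),A]$ on $\mathfrak{gl}(V)$ with real eigenvalues $\ge 0$. Then $\nabla^\Phi$ preserves the filtration of $\mathcal V$ by the subbundles $\mathcal V^\ell=K\times_HV^\ell$ (that is, $\nabla^\Phi s$ has values in $V^\ell$ whenever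 $s$ has) if and only if $\Phi(X)\in\mathfrak{gl}(V)^0$ for all $X\in\mathfrak k$. 3. For any two $K$-invariant linear connections $\nabla,\nabla'$ there is a unique $H$-equivariant linear map $\psi:\mathfrak k\to\mathfrak{gl}(V)$ with $\psi(Y)=0$ for all $Y\in\mathfrak h$ such that $(\nabla s-\nabla's)(k)(X)=\psi(X)(s(k))$ for all $s\in\Gamma(\mathcal V)$, $k\in K$, $X\in\mathfrak k$. 4. Let $s$ be a section with $\nabla^\Phi s=0$. If $s$ is $K$-invariant, then $\Phi(Y)(s)=0$ for all $Y\in\mathfrak k$. If $K$ is connected, then conversely $s$ is $K$-invariant if $\Phi(Y)(s)=0$ for all $Y\in\mathfrak k$. -/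

import Mathlib

open scoped Manifold ContDiff

noncomputable section

namespace HomogeneousConnection

/-! ### Lie groups, Lie algebras, closed subgroups -/

/-- A real `C^∞` Lie group is regular enough to have a Lie algebra. -/
instance lieGroup_minSmoothness {E G : Type*} [NormedAddCommGroup E] [NormedSpace ℝ E]
    [TopologicalSpace G] [ChartedSpace E G] [Group G] [LieGroup 𝓘(ℝ, E) ∞ G] :
    LieGroup 𝓘(ℝ, E) (minSmoothness ℝ 3) G := by
  rw [minSmoothness_of_isRCLikeNormedField]
  exact LieGroup.of_le (n := ∞) (by exact WithTop.coe_le_coe.2 le_top)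

/-- The Lie algebra `T₁K` of a Lie group `K` modelled on the vector space `E`. -/
abbrev LieAlg (E K : Type*) [NormedAddCommGroup E] [NormedSpace ℝ E]
    [TopologicalSpace K] [ChartedSpace E K] [Group K] : Type _ :=
  GroupLieAlgebra 𝓘(ℝ, E) K

section LieGroups

variable {EA A EB B : Type*}
  [NormedAddCommGroup EA] [NormedSpace ℝ EA] [TopologicalSpace A] [ChartedSpace EA A] [Group A]
  [NormedAddCommGroup EB] [NormedSpace ℝ EB] [TopologicalSpace B] [ChartedSpace EB B] [Group B]

/-- The derivative at the identity of a homomorphism `f` of Lie groups, a map from the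
Lie algebra of `A` to the Lie algebra of `B`. -/
def tangentHom (f : A →* B) : LieAlg EA A →L[ℝ] LieAlg EB B :=
  mfderiv 𝓘(ℝ, EA) 𝓘(ℝ, EB) f 1

/-- The adjoint action `Ad(a)`: the derivative at the identity of `x ↦ a x a⁻¹`. -/
def Ad (a : A) : LieAlg EA A →L[ℝ] LieAlg EA A :=
  mfderiv 𝓘(ℝ, EA) 𝓘(ℝ, EA) (fun x : A => a * x * a⁻¹) 1

variable (EA EB) in
/-- `f : A → B` realizes `A` as a closed (embedded) Lie subgroup of `B`. -/
structure IsClosedLieSubgroup (f : A →* B) : Prop where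
  contMDiff : ContMDiff 𝓘(ℝ, EA) 𝓘(ℝ, EB) ∞ f
  isClosedEmbedding : Topology.IsClosedEmbedding f
  injective_tangentHom : Function.Injective (tangentHom (EA := EA) (EB := EB) f)

variable (EA EB) in
/-- The Lie algebra of the subgroup `f : A → B`, as a subspace of the Lie algebra of `B`. -/
def subAlg (f : A →* B) : Submodule ℝ (LieAlg EB B) :=
  LinearMap.range (tangentHom (EA := EA) (EB := EB) f).toLinearMap

variable {V : Type*} [NormedAddCommGroup V] [NormedSpace ℝ V]

/-- The derivative `dρ : 𝔞 → 𝔤𝔩(V)` at the identity of a representation `ρ : A → GL(V)`. -/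
def tangentRep (ρ : A →* (V →L[ℝ] V)) : LieAlg EA A →L[ℝ] (V →L[ℝ] V) :=
  mfderiv 𝓘(ℝ, EA) 𝓘(ℝ, V →L[ℝ] V) ρ 1

end LieGroups

/-! ### Gradings, parabolic subgroups, extensions -/

/-- The filtration attached to an endomorphism `T` of `W`: the component `W^ℓ` is the sum of
the eigenspaces of `T` for all real eigenvalues `j ≥ ℓ`. -/
def eigenFiltration {W : Type*} [AddCommGroup W] [Module ℝ W] (T : Module.End ℝ W) (ℓ : ℝ) :
    Submodule ℝ W :=
  ⨆ (j : ℝ) (_ : ℓ ≤ j), Module.End.eigenspace T j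

/-- The commutator action `A ↦ [T, A] = T A - A T` of `T` on `𝔤𝔩(V)`; for `T = dλ(E)` this is the
action of `E` in the representation of `P` on `𝔤𝔩(V)` induced by `λ`. -/
def commutatorEnd {V : Type*} [NormedAddCommGroup V] [NormedSpace ℝ V] (T : V →L[ℝ] V) :
    Module.End ℝ (V →L[ℝ] V) :=
  LinearMap.mulLeft ℝ T - LinearMap.mulRight ℝ T

section Parabolic

variable {EG G EP P EK K EH H : Type*}
  [NormedAddCommGroup EG] [NormedSpace ℝ EG] [FiniteDimensional ℝ EG]
  [TopologicalSpace G] [ChartedSpace EG G] [Group G] [LieGroup 𝓘(ℝ, EG) ∞ G]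
  [NormedAddCommGroup EP] [NormedSpace ℝ EP]
  [TopologicalSpace P] [ChartedSpace EP P] [Group P]
  [NormedAddCommGroup EK] [NormedSpace ℝ EK]
  [TopologicalSpace K] [ChartedSpace EK K] [Group K]
  [NormedAddCommGroup EH] [NormedSpace ℝ EH]
  [TopologicalSpace H] [ChartedSpace EH H] [Group H]

/-- The component `𝔤_n`, i.e. `{X : [E, X] = n X}`, of the grading given by `E`. -/
def gradeSpace (E : LieAlg EG G) (n : ℤ) : Submodule ℝ (LieAlg EG G) :=
  Module.End.eigenspace (LieAlgebra.ad ℝ (LieAlg EG G) E) (n : ℝ)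

variable (EP) in
/-- `j : P → G` realizes `P` as a parabolic subgroup of `G` with grading element `E ∈ 𝔭`:
`P` is a closed subgroup, `E` is the grading element of a `|k|`-grading
`𝔤 = 𝔤_{-k} ⊕ ⋯ ⊕ 𝔤_k` whose negative part is generated by `𝔤_{-1}`, the Lie algebra of `P` is
`𝔭 = 𝔤_0 ⊕ ⋯ ⊕ 𝔤_k`, and the adjoint action of `P` preserves the filtration
`𝔤^ℓ = ⨁_{n ≥ ℓ} 𝔤_n`. (The compatibility of the bracket with the grading and the directness of
the sum are automatic for eigenspaces of `ad E`.) -/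
structure IsParabolic (j : P →* G) (E : LieAlg EP P) : Prop where
  isClosedLieSubgroup : IsClosedLieSubgroup EP EG j
  grading : ∃ k : ℕ, ⨆ n ∈ Set.Icc (-(k : ℤ)) k, gradeSpace (EG := EG) (tangentHom j E) n = ⊤
  generated : ∀ n : ℤ, n < 0 → gradeSpace (EG := EG) (tangentHom j E) n ≤
    (LieSubalgebra.lieSpan ℝ (LieAlg EG G)
      (gradeSpace (EG := EG) (tangentHom j E) (-1) : Submodule ℝ (LieAlg EG G))).toSubmodule
  lieAlg_eq : subAlg EP EG j = ⨆ (n : ℤ) (_ : 0 ≤ n), gradeSpace (EG := EG) (tangentHom j E) n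
  ad_mem : ∀ (p : P) (ℓ : ℝ), ∀ X ∈ eigenFiltration
      (LieAlgebra.ad ℝ (LieAlg EG G) (tangentHom j E)) ℓ,
    Ad (EA := EG) (j p) X ∈ eigenFiltration (LieAlgebra.ad ℝ (LieAlg EG G) (tangentHom j E)) ℓ

variable (EH EP) in
/-- `(α, i)` is an extension of `(K, H)` to `(G, P)`, where the subgroups are given by
`ι : H → K` and `j : P → G`: `i` is an injective homomorphism of Lie groups, `α : 𝔨 → 𝔤` is
linear, `H`-equivariant, restricts to `di` on `𝔥`, and induces an isomorphism `𝔨/𝔥 → 𝔤/𝔭`. -/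
structure IsExtension (ι : H →* K) (j : P →* G) (i : H →* P)
    (α : LieAlg EK K →ₗ[ℝ] LieAlg EG G) : Prop where
  contMDiff : ContMDiff 𝓘(ℝ, EH) 𝓘(ℝ, EP) ∞ i
  injective : Function.Injective i
  equivariant : ∀ (h : H) (X : LieAlg EK K), α (Ad (ι h) X) = Ad (j (i h)) (α X)
  restrict : ∀ Y : LieAlg EH H,
    α (tangentHom ι Y) = tangentHom j (tangentHom (EB := EP) i Y)
  bijective_quotient : ∃ hα : subAlg EH EK ι ≤ (subAlg EP EG j).comap α,
    Function.Bijective (Submodule.mapQ (subAlg EH EK ι) (subAlg EP EG j) α hα)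

end Parabolic

/-! ### Sections of associated bundles over `K/H` and invariant connections

Sections of the bundle `K ×_H W → K/H` associated to a representation `σ` of `H` on `W` are
smooth maps `s : K → W` with `s(kh) = σ(h)⁻¹ s(k)`. -/

section Connections

variable {EK K EH H V : Type*}
  [NormedAddCommGroup EK] [NormedSpace ℝ EK]
  [TopologicalSpace K] [ChartedSpace EK K] [Group K] [LieGroup 𝓘(ℝ, EK) ∞ K]
  [NormedAddCommGroup EH] [NormedSpace ℝ EH]
  [TopologicalSpace H] [ChartedSpace EH H] [Group H]
  [NormedAddCommGroup V] [NormedSpace ℝ V]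

variable (EK) in
/-- The ring `C^∞(K/H)`: smooth functions on `K` that are constant on the cosets `kH`. -/
def baseFunctions (ι : H →* K) : Set (K → ℝ) :=
  {f | ContMDiff 𝓘(ℝ, EK) 𝓘(ℝ, ℝ) ∞ f ∧ ∀ (k : K) (h : H), f (k * ι h) = f k}

variable (EK) in
/-- The space `Γ(𝒱)` of sections of `𝒱 = K ×_H V`. -/
def sections (ι : H →* K) (ρ : H →* (V →L[ℝ] V)) : Submodule ℝ (K → V) where
  carrier := {s | ContMDiff 𝓘(ℝ, EK) 𝓘(ℝ, V) ∞ s ∧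
    ∀ (k : K) (h : H), s (k * ι h) = ρ h⁻¹ (s k)}
  add_mem' hs ht := ⟨hs.1.add ht.1, fun k h => by simp [hs.2, ht.2]⟩
  zero_mem' := ⟨contMDiff_const, fun k h => by simp⟩
  smul_mem' c _ hs := ⟨(contMDiff_const (c := c) (I' := 𝓘(ℝ, ℝ))).smul hs.1, fun k h => by simp [hs.2]⟩

variable (EK EH) in
/-- The space `Γ(T^*(K/H) ⊗ 𝒱)`: since `T(K/H) = K ×_H (𝔨/𝔥)`, its elements are the smooth
`H`-equivariant maps from `K` to the linear maps `𝔨 → V` that vanish on `𝔥`. -/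
def oneForms (ι : H →* K) (ρ : H →* (V →L[ℝ] V)) : Submodule ℝ (K → LieAlg EK K →ₗ[ℝ] V) where
  carrier := {A | (∀ X, ContMDiff 𝓘(ℝ, EK) 𝓘(ℝ, V) ∞ (fun k => A k X)) ∧
    (∀ (k : K) (h : H) (X : LieAlg EK K), A (k * ι h) X = ρ h⁻¹ (A k (Ad (ι h) X))) ∧
    ∀ k, ∀ X ∈ subAlg EH EK ι, A k X = 0}
  add_mem' hA hB := ⟨fun X => (hA.1 X).add (hB.1 X), fun k h X => by simp [hA.2.1, hB.2.1],
    fun k X hX => by simp [hA.2.2 k X hX, hB.2.2 k X hX]⟩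
  zero_mem' := ⟨fun X => contMDiff_const, fun k h X => by simp, fun k X hX => by simp⟩
  smul_mem' c _ hA := ⟨fun X => (contMDiff_const (c := c) (I' := 𝓘(ℝ, ℝ))).smul (hA.1 X), fun k h X => by simp [hA.2.1],
    fun k X hX => by simp [hA.2.2 k X hX]⟩

/-- The fundamental derivative `D^𝔨`: `(D^𝔨 s)(k)(X)` is the derivative of `s` at `k` in the
direction of the left-invariant vector field on `K` with value `X` at the identity. -/
def fundDeriv {W : Type*} [NormedAddCommGroup W] [NormedSpace ℝ W] (s : K → W) (k : K) :
    LieAlg EK K →ₗ[ℝ] W where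
  toFun X := (mfderiv 𝓘(ℝ, EK) 𝓘(ℝ, W) s k (mulInvariantVectorField X k) : W)
  map_add' X Y := by
    rw [mulInvariantVectorField_add]
    exact map_add (mfderiv 𝓘(ℝ, EK) 𝓘(ℝ, W) s k) _ _
  map_smul' c X := by
    rw [mulInvariantVectorField_smul]
    exact map_smul (mfderiv 𝓘(ℝ, EK) 𝓘(ℝ, W) s k) _ _

variable {ι : H →* K} {ρ : H →* (V →L[ℝ] V)}

/-- The section `f s`, for `f ∈ C^∞(K/H)` and `s ∈ Γ(𝒱)`. -/
def mulSection (f : baseFunctions EK ι) (s : sections EK ι ρ) : sections EK ι ρ :=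
  ⟨fun k => f.1 k • s.1 k, f.2.1.smul s.2.1, fun k h => by simp [f.2.2, s.2.2]⟩

/-- The action of `g ∈ K` on sections of `𝒱`: `(g · s)(k) = s(g⁻¹ k)`. -/
def translateSection (g : K) (s : sections EK ι ρ) : sections EK ι ρ :=
  ⟨fun k => s.1 (g⁻¹ * k), s.2.1.comp (contMDiff_mul_left (I := 𝓘(ℝ, EK)) (a := g⁻¹)),
    fun k h => by beta_reduce; rw [← mul_assoc]; exact s.2.2 _ _⟩

/-- The action of `g ∈ K` on sections of `T^*(K/H) ⊗ 𝒱`: `(g · A)(k) = A(g⁻¹ k)`. -/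
def translateForm (g : K) (A : oneForms EK EH ι ρ) : oneForms EK EH ι ρ :=
  ⟨fun k => A.1 (g⁻¹ * k),
    fun X => (A.2.1 X).comp (contMDiff_mul_left (I := 𝓘(ℝ, EK)) (a := g⁻¹)),
    fun k h X => by beta_reduce; rw [← mul_assoc]; exact A.2.2.1 _ _ _,
    fun k X hX => A.2.2.2 _ X hX⟩

variable (EK EH ι ρ) in
/-- A linear connection `∇ : Γ(𝒱) → Γ(T^*(K/H) ⊗ 𝒱)`: a linear map with
`∇(f s) = df ⊗ s + f ∇s` for `f ∈ C^∞(K/H)`. -/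
structure LinearConnection where
  toLinearMap : sections EK ι ρ →ₗ[ℝ] oneForms EK EH ι ρ
  leibniz : ∀ (f : baseFunctions EK ι) (s : sections EK ι ρ) (k : K) (X : LieAlg EK K),
    (toLinearMap (mulSection f s)).1 k X =
      fundDeriv f.1 k X • s.1 k + f.1 k • (toLinearMap s).1 k X

/-- `∇.eval s k X` is the value `(∇s)(k)(X) ∈ V`. -/
def LinearConnection.eval (D : LinearConnection EK EH ι ρ) (s : sections EK ι ρ) (k : K)
    (X : LieAlg EK K) : V :=
  (D.toLinearMap s).1 k X

/-- `K`-invariance of a connection: `∇(g · s) = g · ∇s`. -/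
def LinearConnection.IsInvariant (D : LinearConnection EK EH ι ρ) : Prop :=
  ∀ (g : K) (s : sections EK ι ρ),
    D.toLinearMap (translateSection g s) = translateForm g (D.toLinearMap s)

/-- `∇` preserves the filtration of `𝒱` by the subbundles `𝒱^ℓ = K ×_H V^ℓ`: if
`s ∈ Γ(𝒱^ℓ)`, then `∇s ∈ Γ(T^*(K/H) ⊗ 𝒱^ℓ)`. -/
def LinearConnection.PreservesFiltration (D : LinearConnection EK EH ι ρ)
    (F : ℝ → Submodule ℝ V) : Prop :=
  ∀ (ℓ : ℝ) (s : sections EK ι ρ), (∀ k, s.1 k ∈ F ℓ) → ∀ k X, D.eval s k X ∈ F ℓ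

/-- A section `s` is parallel if `∇s = 0`. -/
def LinearConnection.IsParallel (D : LinearConnection EK EH ι ρ) (s : sections EK ι ρ) : Prop :=
  D.toLinearMap s = 0

/-- A section `s` is `K`-invariant if `g · s = s` for all `g ∈ K`. -/
def IsInvariantSection (s : sections EK ι ρ) : Prop :=
  ∀ g : K, translateSection g s = s

variable (ι ρ) in
/-- `H`-equivariance of a linear map `Φ : 𝔨 → 𝔤𝔩(V)`. -/
def IsEquivariantMap (Φ : LieAlg EK K →ₗ[ℝ] (V →L[ℝ] V)) : Prop :=
  ∀ (h : H) (X : LieAlg EK K), Φ (Ad (ι h) X) = ρ h * Φ X * ρ h⁻¹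

end Connections

/-- `Φ = dλ ∘ α` on `𝔥`; here `dλ` is defined on the Lie algebra of `P`, which is identified with
`𝔭 ⊆ 𝔤` through the derivative of `j`, and `α` maps `𝔥` into `𝔭`. -/
def RestrictsToRep {EK K H EG G P V : Type*} (EH EP : Type*)
    [NormedAddCommGroup EK] [NormedSpace ℝ EK]
    [TopologicalSpace K] [ChartedSpace EK K] [Group K]
    [NormedAddCommGroup EH] [NormedSpace ℝ EH]
    [TopologicalSpace H] [ChartedSpace EH H] [Group H]
    [NormedAddCommGroup EG] [NormedSpace ℝ EG]
    [TopologicalSpace G] [ChartedSpace EG G] [Group G]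
    [NormedAddCommGroup EP] [NormedSpace ℝ EP]
    [TopologicalSpace P] [ChartedSpace EP P] [Group P]
    [NormedAddCommGroup V] [NormedSpace ℝ V]
    (ι : H →* K) (j : P →* G) (α : LieAlg EK K →ₗ[ℝ] LieAlg EG G) (lam : P →* (V →L[ℝ] V))
    (Φ : LieAlg EK K →ₗ[ℝ] (V →L[ℝ] V)) : Prop :=
  ∀ Y ∈ subAlg EH EK ι, ∀ Z : LieAlg EP P, tangentHom j Z = α Y → Φ Y = tangentRep lam Z

end HomogeneousConnection

end

/-!
Everything rests on a supply of sections and on one tensoriality argument.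

A smooth function `K → V` becomes a section of `𝒱` by averaging it over `H` against Haar measure
(`average_mem_sections`), once it is cut off so that the integral is over a compact set; this uses
that `H` is closed and embedded. Averages of vector-valued bump functions near the identity
have values at the identity that exhaust `V`, and if the bump functions take values in an
`H`-invariant subspace, then so do the sections, whose values exhaust that subspace
(`exists_section_eq`). By the same averaging every section `s` satisfies
`f s = ∑ f_a s_a` with global sections `s_a` that form a frame near the identity and functions `f`,
`f_a` on `K/H`, where `f(1) ≠ 0`, and `f_a(1) = 0` if `s(1) = 0` (`exists_cutoff_expansion`).

Applying the Leibniz rule to such an expansion shows that `∇s - D^𝔨 s` at the identity depends only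
on `s(1)`: the derivatives of the coefficients cancel. Hence it has the form `Φ(X)(s(1))`, and
invariance transports this to all of `K`. Equivariance of the form `∇s` makes `Φ` equivariant, and
since `∇s` vanishes on `𝔥` while the derivative of `s` along `Y ∈ 𝔥` is `-d(λ ∘ i)(Y) s`, the map
`Φ` restricts to `d(λ ∘ i)` on `𝔥` (`LinearConnection.IsInvariant.exists_eval_eq`). The converse
construction is `connectionOf`. As every vector of `V` is the value of a section, `Φ` is unique,
and the difference of two invariant connections is the difference of their maps.

For the filtration, `Ad(p) E - E` lies in positive degree for `p ∈ P`: it has degree at least `0`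
because `Ad(P)` preserves the filtration, and its degree-zero part is central, since `Ad(p) E` and `E`
act by the same scalars on the quotients of the filtration, hence zero by semisimplicity
(`IsParabolic.Ad_sub_mem`). So `λ(p)` carries `dλ(E)` to `dλ(E)` plus a
term raising degree, which forces `λ(p)` to preserve each `V^ℓ`
(`IsParabolic.rep_mem_eigenFiltration`). Sections with values in `V^ℓ` therefore exist through every
vector of `V^ℓ`. The fundamental derivative stays in a fixed subspace, so `∇^Φ` preserves the
filtration exactly when each `Φ(X)` preserves every `V^ℓ`, which is membership in `𝔤𝔩(V)^0`
(`mem_eigenFiltration_commutatorEnd_iff`).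

Finally, an invariant section is a constant function on `K`, and on connected `K` a function with
vanishing fundamental derivative is constant (`eq_of_fundDeriv_eq_zero`).
-/

noncomputable section
namespace HomogeneousConnection

/-! ### Derivatives of maps between manifolds modelled on vector spaces -/

section Calculus

variable {EA A EB B EC C F F' : Type*}
  [NormedAddCommGroup EA] [NormedSpace ℝ EA] [TopologicalSpace A] [ChartedSpace EA A]
  [NormedAddCommGroup EB] [NormedSpace ℝ EB] [TopologicalSpace B] [ChartedSpace EB B]
  [NormedAddCommGroup EC] [NormedSpace ℝ EC] [TopologicalSpace C] [ChartedSpace EC C]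
  [NormedAddCommGroup F] [NormedSpace ℝ F] [NormedAddCommGroup F'] [NormedSpace ℝ F']

/-- The derivative of a map between manifolds without boundary, with all tangent spaces
replaced by the model spaces to which they are definitionally equal. -/
def flatDeriv (f : A → B) (a : A) : EA →L[ℝ] EB := mfderiv 𝓘(ℝ, EA) 𝓘(ℝ, EB) f a

theorem flatDeriv_comp {g : B → C} {f : A → B} {a : A}
    (hg : MDifferentiableAt 𝓘(ℝ, EB) 𝓘(ℝ, EC) g (f a))
    (hf : MDifferentiableAt 𝓘(ℝ, EA) 𝓘(ℝ, EB) f a) :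
    (flatDeriv (fun x => g (f x)) a : EA →L[ℝ] EC) =
      (flatDeriv g (f a) : EB →L[ℝ] EC) ∘L (flatDeriv f a : EA →L[ℝ] EB) :=
  mfderiv_comp (I := 𝓘(ℝ, EA)) (I' := 𝓘(ℝ, EB)) (I'' := 𝓘(ℝ, EC)) a hg hf

theorem flatDeriv_comp_apply {g : B → C} {f : A → B} {a : A}
    (hg : MDifferentiableAt 𝓘(ℝ, EB) 𝓘(ℝ, EC) g (f a))
    (hf : MDifferentiableAt 𝓘(ℝ, EA) 𝓘(ℝ, EB) f a) (v : EA) :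
    (flatDeriv (fun x => g (f x)) a v : EC) =
      (flatDeriv g (f a) : EB →L[ℝ] EC) (flatDeriv f a v : EB) := by
  rw [flatDeriv_comp hg hf]; rfl

theorem flatDeriv_eq_fderiv (f : F → F') (x : F) : flatDeriv f x = fderiv ℝ f x :=
  mfderiv_eq_fderiv

theorem flatDeriv_clm_comp {s : A → F} {a : A} (L : F →L[ℝ] F')
    (hs : MDifferentiableAt 𝓘(ℝ, EA) 𝓘(ℝ, F) s a) :
    (flatDeriv (fun x => L (s x)) a : EA →L[ℝ] F') = L ∘L (flatDeriv s a) := by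
  rw [flatDeriv_comp L.mdifferentiableAt hs, flatDeriv_eq_fderiv, ContinuousLinearMap.fderiv]

theorem flatDeriv_clm_comp_apply {s : A → F} {a : A} (L : F →L[ℝ] F')
    (hs : MDifferentiableAt 𝓘(ℝ, EA) 𝓘(ℝ, F) s a) (v : EA) :
    (flatDeriv (fun x => L (s x)) a v : F') = L (flatDeriv s a v) := by
  rw [flatDeriv_clm_comp L hs]; rfl

theorem flatDeriv_add {s t : A → F} {a : A} (hs : MDifferentiableAt 𝓘(ℝ, EA) 𝓘(ℝ, F) s a)
    (ht : MDifferentiableAt 𝓘(ℝ, EA) 𝓘(ℝ, F) t a) :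
    (flatDeriv (s + t) a : EA →L[ℝ] F) = flatDeriv s a + flatDeriv t a :=
  mfderiv_add hs ht

theorem flatDeriv_const (b : B) (a : A) : (flatDeriv (fun _ => b) a : EA →L[ℝ] EB) = 0 :=
  mfderiv_const

theorem flatDeriv_id (a : A) : (flatDeriv (fun x => x) a : EA →L[ℝ] EA) = .id ℝ EA :=
  mfderiv_id

theorem flatDeriv_congr {f g : A → B} {a : A} (h : f =ᶠ[nhds a] g) :
    (flatDeriv f a : EA →L[ℝ] EB) = flatDeriv g a :=
  Filter.EventuallyEq.mfderiv_eq h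

/-- The product rule for a product given by a continuous bilinear map. -/
theorem flatDeriv_bilin {F'' : Type*} [NormedAddCommGroup F''] [NormedSpace ℝ F'']
    (b : F →L[ℝ] F' →L[ℝ] F'') {s : A → F} {t : A → F'} {a : A}
    (hs : MDifferentiableAt 𝓘(ℝ, EA) 𝓘(ℝ, F) s a)
    (ht : MDifferentiableAt 𝓘(ℝ, EA) 𝓘(ℝ, F') t a) (v : EA) :
    (flatDeriv (fun x => b (s x) (t x)) a v : F'') =
      b (flatDeriv s a v) (t a) + b (s a) (flatDeriv t a v) := by
  have hst : MDifferentiableAt 𝓘(ℝ, EA) 𝓘(ℝ, F × F') (fun x => (s x, t x)) a :=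
    hs.prodMk_space ht
  have hb := b.hasFDerivAt_of_bilinear (hasFDerivAt_fst (𝕜 := ℝ) (p := (s a, t a)))
    (hasFDerivAt_snd (𝕜 := ℝ) (p := (s a, t a)))
  have h1 := flatDeriv_comp_apply (g := fun p : F × F' => b p.1 p.2) (EB := F × F')
    (f := fun x => (s x, t x)) hb.differentiableAt.mdifferentiableAt hst v
  have h2 : (flatDeriv s a v : F) = (flatDeriv (fun x => (s x, t x)) a v : F × F').1 :=
    flatDeriv_clm_comp_apply (ContinuousLinearMap.fst ℝ F F') hst v
  have h3 : (flatDeriv t a v : F') = (flatDeriv (fun x => (s x, t x)) a v : F × F').2 :=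
    flatDeriv_clm_comp_apply (ContinuousLinearMap.snd ℝ F F') hst v
  rw [h1, h2, h3, flatDeriv_eq_fderiv, hb.fderiv]
  simp [add_comm]

/-- The derivative at a moving point of a smooth family of maps between vector spaces depends
smoothly on the parameter. -/
theorem contMDiffAt_flatDeriv_space {EN HN N : Type*} [NormedAddCommGroup EN] [NormedSpace ℝ EN]
    [TopologicalSpace HN] [TopologicalSpace N] [ChartedSpace HN N] {J : ModelWithCorners ℝ EN HN}
    [IsManifold J 1 N]
    {f : N → F → F'} {g : N → F} {a : N}
    (hf : ContMDiffAt (J.prod 𝓘(ℝ, F)) 𝓘(ℝ, F') ∞ (Function.uncurry f) (a, g a))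
    (hg : ContMDiffAt J 𝓘(ℝ, F) ∞ g a) :
    ContMDiffAt J 𝓘(ℝ, F →L[ℝ] F') ∞
      (fun x => (flatDeriv (f x) (g x) : F →L[ℝ] F')) a := by
  have h := ContMDiffAt.mfderiv (I := 𝓘(ℝ, F)) (I' := 𝓘(ℝ, F')) (J := J)
    (x₀ := a) (m := ∞) (n := ∞) f g hf hg le_rfl
  have e := inTangentCoordinates_model_space (I := 𝓘(ℝ, F)) (I' := 𝓘(ℝ, F')) g
    (fun x => f x (g x)) (fun x => (flatDeriv (f x) (g x) : F →L[ℝ] F')) a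
  exact h.congr_of_eventuallyEq (Filter.Eventually.of_forall fun x => (congrFun e x).symm)

/-- The derivative at a fixed point of a smooth family of maps depends smoothly on the
parameter. -/
theorem contMDiffAt_flatDeriv_param [IsManifold 𝓘(ℝ, EB) ∞ B] [IsManifold 𝓘(ℝ, EA) ∞ A]
    {f : A → B → F} {a : A} {b : B}
    (hf : ContMDiffAt (𝓘(ℝ, EA).prod 𝓘(ℝ, EB)) 𝓘(ℝ, F) ∞ (Function.uncurry f) (a, b)) (v : EB) :
    ContMDiffAt 𝓘(ℝ, EA) 𝓘(ℝ, F) ∞ (fun x => (flatDeriv (f x) b v : F)) a := by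
  have : IsManifold 𝓘(ℝ, EB) 1 B := IsManifold.of_le (n := ∞) (by simp)
  have h := ContMDiffAt.mfderiv_apply (I := 𝓘(ℝ, EB)) (I' := 𝓘(ℝ, F)) (J := 𝓘(ℝ, EA))
    (J' := 𝓘(ℝ, EA))
    (x₀ := a) (m := ∞) (n := ∞) f (fun _ => b) id
    (fun _ => v) hf contMDiffAt_const contMDiffAt_id contMDiffAt_const le_rfl
  refine h.congr_of_eventuallyEq (Filter.Eventually.of_forall fun x => ?_)
  have h2 := inTangentCoordinates_eq (I := 𝓘(ℝ, EB)) (I' := 𝓘(ℝ, F)) (fun _ : A => b) (fun x => f x b)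
    (fun x => (flatDeriv (f x) b : EB →L[ℝ] F)) (x₀ := a) (x := x)
    (by simp) (Set.mem_univ _)
  refine (Eq.trans (congrArg (fun L : EB →L[ℝ] F => L v) h2) ?_).symm
  have h3 : ((tangentBundleCore 𝓘(ℝ, EB) B).coordChange (achart EB b) (achart EB b) b) v = v :=
    (tangentBundleCore 𝓘(ℝ, EB) B).coordChange_self _ _ (by simp) _
  rw [tangentBundleCore_coordChange_model_space]
  exact congrArg (flatDeriv (f x) b : EB →L[ℝ] F) h3

end Calculus

/-! ### The fundamental derivative -/

section FundDeriv

variable {EK K F F' : Type*}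
  [NormedAddCommGroup EK] [NormedSpace ℝ EK]
  [TopologicalSpace K] [ChartedSpace EK K] [Group K] [LieGroup 𝓘(ℝ, EK) ∞ K]
  [NormedAddCommGroup F] [NormedSpace ℝ F] [NormedAddCommGroup F'] [NormedSpace ℝ F']

omit [Group K] [LieGroup 𝓘(ℝ, EK) ∞ K] in
theorem mdifferentiableAt_of_contMDiff {EL L : Type*} [NormedAddCommGroup EL] [NormedSpace ℝ EL]
    [TopologicalSpace L] [ChartedSpace EL L]
    {s : K → L} (hs : ContMDiff 𝓘(ℝ, EK) 𝓘(ℝ, EL) ∞ s) (k : K) :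
    MDifferentiableAt 𝓘(ℝ, EK) 𝓘(ℝ, EL) s k :=
  hs.mdifferentiableAt (by simp)

theorem contMDiff_leftMul (g : K) : ContMDiff 𝓘(ℝ, EK) 𝓘(ℝ, EK) ∞ (fun x : K => g * x) :=
  contMDiff_mul_left

theorem contMDiff_conj (g : K) : ContMDiff 𝓘(ℝ, EK) 𝓘(ℝ, EK) ∞ (fun x : K => g * x * g⁻¹) :=
  (contMDiff_mul_right (a := g⁻¹)).comp (contMDiff_mul_left (a := g))

/-- The identification of the Lie algebra with the model space. -/
def toModel (X : LieAlg EK K) : EK := X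

theorem fundDeriv_eq_flatDeriv {s : K → F} {k : K}
    (hs : MDifferentiableAt 𝓘(ℝ, EK) 𝓘(ℝ, F) s k) (X : LieAlg EK K) :
    fundDeriv s k X = flatDeriv (EA := EK) (EB := F) (fun x => s (k * x)) 1 (toModel X) := by
  have h1 : MDifferentiableAt 𝓘(ℝ, EK) 𝓘(ℝ, F) s (k * 1) := by simpa using hs
  rw [flatDeriv_comp_apply (g := s) (f := fun x => k * x) h1
    (mdifferentiableAt_of_contMDiff (contMDiff_leftMul k) 1), mul_one]
  rfl

theorem fundDeriv_translate {s : K → F} (hs : ContMDiff 𝓘(ℝ, EK) 𝓘(ℝ, F) ∞ s) (g k : K)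
    (X : LieAlg EK K) :
    fundDeriv (fun x => s (g * x)) k X = fundDeriv s (g * k) X := by
  rw [fundDeriv_eq_flatDeriv (mdifferentiableAt_of_contMDiff hs _),
    fundDeriv_eq_flatDeriv (s := fun x => s (g * x))
      (mdifferentiableAt_of_contMDiff (hs.comp (contMDiff_leftMul g)) _)]
  simp only [mul_assoc]

theorem contMDiff_fundDeriv {s : K → F} (hs : ContMDiff 𝓘(ℝ, EK) 𝓘(ℝ, F) ∞ s)
    (X : LieAlg EK K) :
    ContMDiff 𝓘(ℝ, EK) 𝓘(ℝ, F) ∞ (fun k => fundDeriv s k X) := by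
  have h : (fun k => fundDeriv s k X) =
      fun k => flatDeriv (EA := EK) (EB := F) (fun x => s (k * x)) 1 (toModel X) := by
    funext k
    exact fundDeriv_eq_flatDeriv (mdifferentiableAt_of_contMDiff hs k) X
  rw [h]
  have hF : ContMDiff (𝓘(ℝ, EK).prod 𝓘(ℝ, EK)) 𝓘(ℝ, F) ∞
      (Function.uncurry fun k x : K => s (k * x)) := hs.comp (contMDiff_mul 𝓘(ℝ, EK) ∞)
  exact fun k => contMDiffAt_flatDeriv_param hF.contMDiffAt _

omit [LieGroup 𝓘(ℝ, EK) ∞ K] in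
theorem fundDeriv_clm_comp {s : K → F} (hs : ContMDiff 𝓘(ℝ, EK) 𝓘(ℝ, F) ∞ s) (L : F →L[ℝ] F')
    (k : K) (X : LieAlg EK K) :
    fundDeriv (fun x => L (s x)) k X = L (fundDeriv s k X) :=
  flatDeriv_clm_comp_apply L (mdifferentiableAt_of_contMDiff hs k) _

omit [LieGroup 𝓘(ℝ, EK) ∞ K] in
theorem fundDeriv_add {s t : K → F} (hs : ContMDiff 𝓘(ℝ, EK) 𝓘(ℝ, F) ∞ s)
    (ht : ContMDiff 𝓘(ℝ, EK) 𝓘(ℝ, F) ∞ t) (k : K) (X : LieAlg EK K) :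
    fundDeriv (s + t) k X = fundDeriv s k X + fundDeriv t k X :=
  congrArg (fun L : EK →L[ℝ] F => L (mulInvariantVectorField X k))
    (flatDeriv_add (mdifferentiableAt_of_contMDiff hs k) (mdifferentiableAt_of_contMDiff ht k))

omit [LieGroup 𝓘(ℝ, EK) ∞ K] in
theorem fundDeriv_smul {f : K → ℝ} {s : K → F} (hf : ContMDiff 𝓘(ℝ, EK) 𝓘(ℝ, ℝ) ∞ f)
    (hs : ContMDiff 𝓘(ℝ, EK) 𝓘(ℝ, F) ∞ s) (k : K) (X : LieAlg EK K) :
    fundDeriv (fun x => f x • s x) k X = fundDeriv f k X • s k + f k • fundDeriv s k X :=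
  flatDeriv_bilin (ContinuousLinearMap.lsmul ℝ ℝ) (mdifferentiableAt_of_contMDiff hf k)
    (mdifferentiableAt_of_contMDiff hs k) _

omit [LieGroup 𝓘(ℝ, EK) ∞ K] in
theorem fundDeriv_const (w : F) (k : K) (X : LieAlg EK K) :
    fundDeriv (fun _ => w) k X = 0 :=
  congrArg (fun L : EK →L[ℝ] F => L (mulInvariantVectorField X k)) (flatDeriv_const w k)

/-- A smooth function with vanishing fundamental derivative has vanishing derivative, because
left-invariant vector fields span the tangent spaces. -/
theorem flatDeriv_eq_zero_of_fundDeriv {s : K → F} (hs : ContMDiff 𝓘(ℝ, EK) 𝓘(ℝ, F) ∞ s) (k : K)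
    (h : ∀ X : LieAlg EK K, fundDeriv s k X = 0) : (flatDeriv s k : EK →L[ℝ] F) = 0 := by
  have e : s = fun x => (fun y => s (k * y)) (k⁻¹ * x) := by simp
  have h0 : (flatDeriv (fun y => s (k * y)) 1 : EK →L[ℝ] F) = 0 := by
    ext X
    exact (fundDeriv_eq_flatDeriv (mdifferentiableAt_of_contMDiff hs k) X).symm.trans (h X)
  rw [e, flatDeriv_comp (g := fun y => s (k * y)) (f := fun x => k⁻¹ * x)
    (mdifferentiableAt_of_contMDiff (hs.comp (contMDiff_leftMul k)) _)
    (mdifferentiableAt_of_contMDiff (contMDiff_leftMul _) _), inv_mul_cancel, h0,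
    ContinuousLinearMap.zero_comp]

/-- A smooth function on a connected Lie group is constant if its fundamental derivative
vanishes. -/
theorem eq_of_fundDeriv_eq_zero [ConnectedSpace K] {s : K → F}
    (hs : ContMDiff 𝓘(ℝ, EK) 𝓘(ℝ, F) ∞ s)
    (h : ∀ k, ∀ X : LieAlg EK K, fundDeriv s k X = 0) (k k' : K) : s k = s k' := by
  have : IsLocallyConstant s := by
    rw [IsLocallyConstant.iff_eventually_eq]
    intro k
    set e := extChartAt 𝓘(ℝ, EK) k
    obtain ⟨r, hr, hball⟩ := Metric.isOpen_iff.1 (isOpen_extChartAt_target (I := 𝓘(ℝ, EK)) k) _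
      (mem_extChartAt_target k)
    have hsymm : ∀ x ∈ Metric.ball (e k) r,
        MDifferentiableAt 𝓘(ℝ, EK) 𝓘(ℝ, EK) e.symm x := fun x hx =>
      ((contMDiffOn_extChartAt_symm (n := ∞) k).contMDiffAt
        ((isOpen_extChartAt_target k).mem_nhds (hball hx))).mdifferentiableAt (by simp)
    have hd : ∀ x ∈ Metric.ball (e k) r, MDifferentiableAt 𝓘(ℝ, EK) 𝓘(ℝ, F) (fun y => s (e.symm y)) x :=
      fun x hx => (mdifferentiableAt_of_contMDiff hs _).comp x (hsymm x hx)
    have hc : ∀ x ∈ Metric.ball (e k) r, s (e.symm x) = s (e.symm (e k)) := by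
      intro x hx
      refine Metric.isOpen_ball.is_const_of_fderiv_eq_zero (𝕜 := ℝ) (f := fun y => s (e.symm y))
        (convex_ball (e k) r).isPreconnected ?_ ?_ hx (Metric.mem_ball_self hr)
      · exact fun y hy => (hd y hy).differentiableAt.differentiableWithinAt
      · intro y hy
        rw [← flatDeriv_eq_fderiv, flatDeriv_comp (mdifferentiableAt_of_contMDiff hs _) (hsymm y hy),
          flatDeriv_eq_zero_of_fundDeriv hs _ (h _)]
        rfl
    have hk : e.symm (e k) = k := extChartAt_to_inv k
    filter_upwards [(continuousAt_extChartAt (I := 𝓘(ℝ, EK)) k).preimage_mem_nhds (Metric.ball_mem_nhds _ hr),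
      extChartAt_source_mem_nhds (I := 𝓘(ℝ, EK)) k] with y hy hy'
    have := hc (e y) hy
    rwa [hk, e.left_inv hy'] at this
  exact this.apply_eq_of_preconnectedSpace k k'

end FundDeriv

/-! ### Homomorphisms of Lie groups -/

section Hom

variable {EA A EB B F : Type*}
  [NormedAddCommGroup EA] [NormedSpace ℝ EA] [TopologicalSpace A] [ChartedSpace EA A] [Group A]
  [NormedAddCommGroup EB] [NormedSpace ℝ EB] [TopologicalSpace B] [ChartedSpace EB B] [Group B]
  [LieGroup 𝓘(ℝ, EA) ∞ A] [LieGroup 𝓘(ℝ, EB) ∞ B]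
  [NormedAddCommGroup F] [NormedSpace ℝ F]

/-- The chain rule for the fundamental derivative of a function pulled back along a
homomorphism. -/
theorem fundDeriv_comp_hom {f : A →* B} (hf : ContMDiff 𝓘(ℝ, EA) 𝓘(ℝ, EB) ∞ f) {s : B → F} {a : A}
    (hs : MDifferentiableAt 𝓘(ℝ, EB) 𝓘(ℝ, F) s (f a)) (X : LieAlg EA A) :
    fundDeriv (fun x => s (f x)) a X = fundDeriv s (f a) (tangentHom (EB := EB) f X) := by
  have h1 : MDifferentiableAt 𝓘(ℝ, EB) 𝓘(ℝ, F) (fun y => s (f a * y)) (f 1) := by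
    have : MDifferentiableAt 𝓘(ℝ, EB) 𝓘(ℝ, F) s (f a * f 1) := by simpa using hs
    exact this.comp _ (mdifferentiableAt_of_contMDiff (contMDiff_leftMul _) _)
  rw [fundDeriv_eq_flatDeriv (s := fun x => s (f x))
      (hs.comp a (mdifferentiableAt_of_contMDiff hf a)), fundDeriv_eq_flatDeriv hs]
  simp only [map_mul]
  rw [flatDeriv_comp_apply (g := fun y => s (f a * y)) (f := f) h1
    (mdifferentiableAt_of_contMDiff hf 1), map_one]
  rfl

/-- The derivative of a homomorphism intertwines the adjoint actions. -/
theorem tangentHom_Ad {f : A →* B} (hf : ContMDiff 𝓘(ℝ, EA) 𝓘(ℝ, EB) ∞ f) (a : A)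
    (X : LieAlg EA A) :
    tangentHom (EB := EB) f (Ad a X) = Ad (f a) (tangentHom f X) := by
  have h1 := flatDeriv_comp_apply (g := f) (f := fun x : A => a * x * a⁻¹) (a := 1)
    (mdifferentiableAt_of_contMDiff hf _) (mdifferentiableAt_of_contMDiff (contMDiff_conj a) _) X
  have h2 := flatDeriv_comp_apply (g := fun y : B => f a * y * (f a)⁻¹) (f := f) (a := 1)
    (mdifferentiableAt_of_contMDiff (contMDiff_conj (f a)) _)
    (mdifferentiableAt_of_contMDiff hf _) X
  simp only [map_mul, map_inv] at h1
  rw [h1] at h2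
  simp only [mul_one, mul_inv_cancel, map_one] at h2
  exact h2

/-- The derivative of a representation intertwines the adjoint action with conjugation. -/
theorem tangentRep_Ad {r : A →* (F →L[ℝ] F)} (hr : ContMDiff 𝓘(ℝ, EA) 𝓘(ℝ, F →L[ℝ] F) ∞ r) (a : A)
    (X : LieAlg EA A) : tangentRep r (Ad a X) = r a * tangentRep r X * r a⁻¹ := by
  have h1 := flatDeriv_comp_apply (g := r) (f := fun x : A => a * x * a⁻¹) (a := 1)
    (mdifferentiableAt_of_contMDiff hr _) (mdifferentiableAt_of_contMDiff (contMDiff_conj a) _) X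
  have h2 := flatDeriv_clm_comp_apply
    ((ContinuousLinearMap.mul ℝ (F →L[ℝ] F)).flip (r a⁻¹) ∘L
      (ContinuousLinearMap.mul ℝ (F →L[ℝ] F) (r a)))
    (mdifferentiableAt_of_contMDiff hr 1) X
  simp only [map_mul, mul_one, mul_inv_cancel] at h1
  exact h1.symm.trans h2

end Hom

/-! ### The Lie bracket -/

section Bracket

open VectorField

variable {EK K F : Type*}
  [NormedAddCommGroup EK] [NormedSpace ℝ EK] [CompleteSpace EK]
  [TopologicalSpace K] [ChartedSpace EK K] [Group K] [LieGroup 𝓘(ℝ, EK) ∞ K]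
  [NormedAddCommGroup F] [NormedSpace ℝ F]

/-- Differentiation along the bracket of two left-invariant vector fields is the commutator of the
differentiations along these fields. -/
theorem fundDeriv_lie {s : K → F} (hs : ContMDiff 𝓘(ℝ, EK) 𝓘(ℝ, F) ∞ s) (X Y : LieAlg EK K) :
    fundDeriv s 1 ⁅X, Y⁆ =
      fundDeriv (fun k => fundDeriv s k Y) 1 X - fundDeriv (fun k => fundDeriv s k X) 1 Y := by
  have : IsManifold 𝓘(ℝ, EK) (minSmoothness ℝ 3) K := ContMDiffMul.toIsManifold
  set e := extChartAt 𝓘(ℝ, EK) (1 : K) with he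
  have hinv : ∀ x ∈ e.target, (mfderiv 𝓘(ℝ, EK) 𝓘(ℝ, EK) e.symm x).IsInvertible := by
    intro x hx
    have := isInvertible_mfderivWithin_extChartAt_symm (I := 𝓘(ℝ, EK)) hx
    rwa [modelWithCornersSelf_coe, Set.range_id, mfderivWithin_univ] at this
  have htgt : e.target ∈ nhds (e 1) := extChartAt_target_mem_nhds 1
  have hφ : ∀ x ∈ e.target, ContMDiffAt 𝓘(ℝ, EK) 𝓘(ℝ, EK) ∞ e.symm x := fun x hx =>
    (contMDiffOn_extChartAt_symm (n := ∞) (1 : K)).contMDiffAt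
        ((isOpen_extChartAt_target (1 : K)).mem_nhds hx)
  have h1 : e 1 ∈ e.target := mem_extChartAt_target 1
  have hk : e.symm (e 1) = 1 := extChartAt_to_inv 1
  -- the left-invariant vector field of `Z` in the chart
  let P : LieAlg EK K → EK → EK := fun Z =>
    mpullback 𝓘(ℝ, EK) 𝓘(ℝ, EK) e.symm (mulInvariantVectorField Z)
  have hP : ∀ Z, DifferentiableAt ℝ (P Z) (e 1) := by
    intro Z
    have hZ := ((contMDiff_mulInvariantVectorField (I := 𝓘(ℝ, EK)) (G := K) Z)
      (e.symm (e 1))).of_le (m := 1) (by simp [minSmoothness_of_isRCLikeNormedField])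
    have h := ContMDiffAt.mpullback_vectorField_preimage (n := 2) hZ
      ((hφ _ h1).of_le (by exact WithTop.coe_le_coe.2 le_top)) (hinv _ h1)
      (by simp [one_add_one_eq_two])
    exact (contMDiffAt_vectorSpace_iff_contDiffAt.1 h).differentiableAt one_ne_zero
  have hder : ∀ (t : K → F), ContMDiff 𝓘(ℝ, EK) 𝓘(ℝ, F) ∞ t → ∀ Z, ∀ x ∈ e.target,
      fderiv ℝ (fun y => t (e.symm y)) x (P Z x) = fundDeriv t (e.symm x) Z := by
    intro t ht Z x hx
    rw [← flatDeriv_eq_fderiv, flatDeriv_comp_apply (mdifferentiableAt_of_contMDiff ht _)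
      ((hφ x hx).mdifferentiableAt (by simp))]
    exact congrArg (flatDeriv t (e.symm x) : EK →L[ℝ] F)
      ((hinv x hx).self_apply_inverse (mulInvariantVectorField Z (e.symm x)))
  have hbr : (mpullback 𝓘(ℝ, EK) 𝓘(ℝ, EK) e.symm (mulInvariantVectorField ⁅X, Y⁆) (e 1) : EK) =
      lieBracket ℝ (P X) (P Y) (e 1) := by
    have h2 := mpullback_mlieBracket (n := minSmoothness ℝ 2) (I := 𝓘(ℝ, EK)) (I' := 𝓘(ℝ, EK))
      (f := e.symm) (x₀ := e 1)
      (mdifferentiableAt_mulInvariantVectorField X) (mdifferentiableAt_mulInvariantVectorField Y)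
      ((hφ _ h1).of_le (by
        rw [minSmoothness_of_isRCLikeNormedField]; exact WithTop.coe_le_coe.2 le_top)) le_rfl
    have h3 : ∀ U W : EK → EK, mlieBracket 𝓘(ℝ, EK) U W (e 1) = lieBracket ℝ U W (e 1) := by
      intro U W
      rw [← lieBracketWithin_univ]
      exact congrFun (mlieBracketWithin_eq_lieBracketWithin (V := U) (W := W)) (e 1)
    rw [GroupLieAlgebra.bracket_def, mulInvariantVector_mlieBracket]
    exact h2.trans (h3 _ _)
  have hsE : ContDiffAt ℝ ∞ (fun y => s (e.symm y)) (e 1) :=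
    (hs.contMDiffAt.comp (e 1) (hφ _ h1)).contDiffAt
  have key := fderiv_apply_lieBracket hsE
    (by rw [minSmoothness_of_isRCLikeNormedField]; exact WithTop.coe_le_coe.2 le_top) (hP Y) (hP X)
  rw [← hbr, show mpullback 𝓘(ℝ, EK) 𝓘(ℝ, EK) e.symm (mulInvariantVectorField ⁅X, Y⁆) (e 1) =
    P ⁅X, Y⁆ (e 1) from rfl, hder s hs _ _ h1, hk] at key
  rw [key]
  have hc : ∀ Z, (fun x => fderiv ℝ (fun y => s (e.symm y)) x (P Z x)) =ᶠ[nhds (e 1)]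
      fun x => (fun k => fundDeriv s k Z) (e.symm x) := fun Z => by
    filter_upwards [htgt] with x hx using hder s hs Z x hx
  rw [(hc Y).fderiv_eq, (hc X).fderiv_eq, hder _ (contMDiff_fundDeriv hs Y) _ _ h1,
    hder _ (contMDiff_fundDeriv hs X) _ _ h1, hk]

end Bracket

section HomBracket

variable {EA A EB B F : Type*}
  [NormedAddCommGroup EA] [NormedSpace ℝ EA] [TopologicalSpace A] [ChartedSpace EA A] [Group A]
  [NormedAddCommGroup EB] [NormedSpace ℝ EB] [TopologicalSpace B] [ChartedSpace EB B] [Group B]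
  [LieGroup 𝓘(ℝ, EA) ∞ A] [LieGroup 𝓘(ℝ, EB) ∞ B] [CompleteSpace EA]
  [NormedAddCommGroup F] [NormedSpace ℝ F]

omit [CompleteSpace EA] in
theorem fundDeriv_one {s : A → F} (hs : ContMDiff 𝓘(ℝ, EA) 𝓘(ℝ, F) ∞ s) (X : LieAlg EA A) :
    fundDeriv s 1 X = flatDeriv (EA := EA) (EB := F) s 1 (toModel X) := by
  rw [fundDeriv_eq_flatDeriv (mdifferentiableAt_of_contMDiff hs 1)]
  simp only [one_mul]

omit [CompleteSpace EA] in
/-- A representation satisfies the differential equation `D^𝔞 r = r · dr`. -/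
theorem fundDeriv_rep {r : A →* (F →L[ℝ] F)} (hr : ContMDiff 𝓘(ℝ, EA) 𝓘(ℝ, F →L[ℝ] F) ∞ r) (a : A)
    (X : LieAlg EA A) : fundDeriv r a X = r a * tangentRep r X := by
  rw [fundDeriv_eq_flatDeriv (mdifferentiableAt_of_contMDiff hr a)]
  simp only [map_mul]
  exact flatDeriv_clm_comp_apply (ContinuousLinearMap.mul ℝ (F →L[ℝ] F) (r a))
    (mdifferentiableAt_of_contMDiff hr 1) _

/-- The derivative of a representation is a representation of the Lie algebra. -/
theorem tangentRep_lie {r : A →* (F →L[ℝ] F)} (hr : ContMDiff 𝓘(ℝ, EA) 𝓘(ℝ, F →L[ℝ] F) ∞ r)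
    (X Y : LieAlg EA A) : tangentRep r ⁅X, Y⁆ =
      tangentRep r X * tangentRep r Y - tangentRep r Y * tangentRep r X := by
  have h1 : ∀ X : LieAlg EA A, fundDeriv r 1 X = tangentRep r X := fun X => by
    rw [fundDeriv_rep hr, map_one, one_mul]
  have h2 : ∀ X Y : LieAlg EA A, fundDeriv (fun k => fundDeriv r k Y) 1 X =
      tangentRep r X * tangentRep r Y := fun X Y => by
    simp only [fundDeriv_rep hr]
    rw [← h1 X]
    exact fundDeriv_clm_comp hr ((ContinuousLinearMap.mul ℝ (F →L[ℝ] F)).flip (tangentRep r Y)) 1 X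
  rw [← h1, fundDeriv_lie hr, h2, h2]

omit [LieGroup 𝓘(ℝ, EA) ∞ A] [CompleteSpace EA] [Group A] in
/-- Around each point of a Hausdorff manifold there is a globally defined smooth map to the model
space which is injective to first order. -/
theorem exists_contMDiff_flatDeriv_injective [T2Space A] [FiniteDimensional ℝ EA]
    [IsManifold 𝓘(ℝ, EA) ∞ A] (a : A) :
    ∃ f : A → EA, ContMDiff 𝓘(ℝ, EA) 𝓘(ℝ, EA) ∞ f ∧
      Function.Injective (flatDeriv f a : EA →L[ℝ] EA) := by
  have : IsManifold 𝓘(ℝ, EA) 1 A := IsManifold.of_le (n := ∞) (by simp)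
  let χ : SmoothBumpFunction 𝓘(ℝ, EA) a := Classical.arbitrary _
  refine ⟨fun x => χ x • extChartAt 𝓘(ℝ, EA) a x, χ.contMDiff_smul ?_, ?_⟩
  · exact contMDiffOn_extChartAt
  · rw [flatDeriv_congr (g := extChartAt 𝓘(ℝ, EA) a)]
    · exact (isInvertible_mfderiv_extChartAt (mem_extChartAt_source a)).injective
    · filter_upwards [χ.eventuallyEq_one] with x hx
      simp [hx]

/-- The derivative of a homomorphism of Lie groups is a homomorphism of Lie algebras. -/
theorem tangentHom_lie [T2Space B] [FiniteDimensional ℝ EB] {f : A →* B}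
    (hf : ContMDiff 𝓘(ℝ, EA) 𝓘(ℝ, EB) ∞ f) (X Y : LieAlg EA A) :
    tangentHom (EB := EB) f ⁅X, Y⁆ = ⁅tangentHom (EB := EB) f X, tangentHom (EB := EB) f Y⁆ := by
  obtain ⟨s, hs, hinj⟩ := exists_contMDiff_flatDeriv_injective (EA := EB) (1 : B)
  have h1 : ∀ (t : B → EB), ContMDiff 𝓘(ℝ, EB) 𝓘(ℝ, EB) ∞ t → ∀ (a : A) (X : LieAlg EA A),
      fundDeriv (fun x => t (f x)) a X = fundDeriv t (f a) (tangentHom (EB := EB) f X) :=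
    fun t ht a X => fundDeriv_comp_hom hf (mdifferentiableAt_of_contMDiff ht _) X
  have h2 : ∀ X Y : LieAlg EA A,
      fundDeriv (fun k => fundDeriv (fun x => s (f x)) k Y) 1 X =
        fundDeriv (fun k => fundDeriv s k (tangentHom (EB := EB) f Y)) 1
          (tangentHom (EB := EB) f X) := fun X Y => by
    simp only [h1 s hs]
    rw [h1 _ (contMDiff_fundDeriv hs _), map_one]
  have key : fundDeriv s 1 (tangentHom (EB := EB) f ⁅X, Y⁆) =
      fundDeriv s 1 ⁅tangentHom (EB := EB) f X, tangentHom (EB := EB) f Y⁆ := by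
    rw [fundDeriv_lie hs, ← h2, ← h2, ← fundDeriv_lie (s := fun x => s (f x)) (hs.comp hf), h1 s hs, map_one]
  rw [fundDeriv_one hs, fundDeriv_one hs] at key
  exact hinj key

/-- The adjoint action preserves the Lie bracket. -/
theorem Ad_lie [T2Space A] [FiniteDimensional ℝ EA] (a : A) (X Y : LieAlg EA A) :
    Ad a ⁅X, Y⁆ = ⁅Ad a X, Ad a Y⁆ :=
  tangentHom_lie (f := (MulAut.conj a).toMonoidHom) (contMDiff_conj a) X Y

omit [CompleteSpace EA] in
theorem Ad_mul (a b : A) (X : LieAlg EA A) : Ad (a * b) X = Ad a (Ad b X) := by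
  have h1 := flatDeriv_comp_apply (EA := EA) (EB := EA) (EC := EA)
    (g := fun x : A => a * x * a⁻¹) (f := fun x : A => b * x * b⁻¹) (a := 1)
    (mdifferentiableAt_of_contMDiff (contMDiff_conj a) _)
    (mdifferentiableAt_of_contMDiff (contMDiff_conj b) _) (toModel X)
  have e : (fun x : A => a * (b * x * b⁻¹) * a⁻¹) = fun x => a * b * x * (a * b)⁻¹ := by
    funext x; group
  rw [e] at h1
  simp only [mul_one, mul_inv_cancel] at h1
  exact h1

omit [CompleteSpace EA] [LieGroup 𝓘(ℝ, EA) ∞ A] in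
theorem Ad_one (X : LieAlg EA A) : Ad (1 : A) X = X := by
  have h := congrArg (fun L : EA →L[ℝ] EA => L (toModel X)) (flatDeriv_id (EA := EA) (1 : A))
  have e : (fun x : A => x) = fun x => 1 * x * 1⁻¹ := by funext x; simp
  rw [e] at h
  exact h

end HomBracket

/-! ### Diagonalizable endomorphisms and their filtrations -/

section Eigen

variable {W : Type*} [AddCommGroup W] [Module ℝ W] {T : Module.End ℝ W}

theorem eigenspace_le_eigenFiltration {j ℓ : ℝ} (h : ℓ ≤ j) :
    Module.End.eigenspace T j ≤ eigenFiltration T ℓ :=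
  le_iSup₂_of_le j h le_rfl

/-- A spanning family of eigenspaces contains a basis of eigenvectors. -/
theorem exists_eigenbasis [FiniteDimensional ℝ W] {S : Set ℝ}
    (hT : ⨆ c ∈ S, Module.End.eigenspace T c = ⊤) :
    ∃ (n : ℕ) (b : Module.Basis (Fin n) ℝ W) (μ : Fin n → ℝ),
      (∀ a, T (b a) = μ a • b a) ∧ ∀ a, μ a ∈ S := by
  set s : Set W := {w | ∃ c ∈ S, w ∈ Module.End.eigenspace T c}
  have hs : ⊤ ≤ Submodule.span ℝ s := by
    rw [← hT]
    exact iSup₂_le fun c hc w hw => Submodule.subset_span ⟨c, hc, hw⟩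
  let b₀ := Module.Basis.ofSpan hs
  have : Fintype _ := FiniteDimensional.fintypeBasisIndex b₀
  let b := b₀.reindex (Fintype.equivFin _)
  have hb : ∀ a, b a ∈ s := fun a => by
    rw [Module.Basis.reindex_apply]
    exact Module.Basis.ofSpan_subset hs (Set.mem_range_self _)
  choose μ hμS hμ using hb
  exact ⟨_, b, μ,
    fun a => Module.End.mem_eigenspace_iff.1 (hμ a), hμS⟩

variable {κ : Type*} [Fintype κ] {b : Module.Basis κ ℝ W} {μ : κ → ℝ}

theorem repr_apply_of_eigenbasis (hb : ∀ a, T (b a) = μ a • b a) (w : W) (a : κ) :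
    b.repr (T w) a = μ a * b.repr w a := by
  classical
  conv_lhs => rw [← b.sum_repr w]
  simp only [map_sum, map_smul, hb, Module.Basis.repr_self, Finsupp.coe_finsetSum,
    Finset.sum_apply, Finsupp.coe_smul, Pi.smul_apply, Finsupp.single_apply, smul_eq_mul]
  rw [Finset.sum_eq_single a]
  · simp [mul_comm]
  · intro c _ hc; simp [hc]
  · simp

theorem mem_eigenspace_iff_repr (hb : ∀ a, T (b a) = μ a • b a) {w : W} {c : ℝ} :
    w ∈ Module.End.eigenspace T c ↔ ∀ a, μ a ≠ c → b.repr w a = 0 := by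
  rw [Module.End.mem_eigenspace_iff, ← b.repr.injective.eq_iff, Finsupp.ext_iff]
  refine forall_congr' fun a => ?_
  rw [repr_apply_of_eigenbasis hb, map_smul, Finsupp.smul_apply, smul_eq_mul, mul_eq_mul_right_iff]
  tauto

/-- The filtration in terms of a basis of eigenvectors: all coordinates belonging to smaller
eigenvalues vanish. -/
theorem mem_eigenFiltration_iff_repr (hb : ∀ a, T (b a) = μ a • b a) {w : W} {ℓ : ℝ} :
    w ∈ eigenFiltration T ℓ ↔ ∀ a, μ a < ℓ → b.repr w a = 0 := by
  constructor
  · intro hw a ha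
    have : eigenFiltration T ℓ ≤ LinearMap.ker (b.coord a) := iSup₂_le fun j hj w hw =>
      (mem_eigenspace_iff_repr hb).1 hw a (ha.trans_le hj).ne
    exact this hw
  · intro h
    rw [← b.sum_repr w]
    refine Submodule.sum_mem _ fun a _ => ?_
    rcases lt_or_ge (μ a) ℓ with ha | ha
    · rw [h a ha, zero_smul]; exact zero_mem _
    · exact Submodule.smul_mem _ _ (eigenspace_le_eigenFiltration ha
        (Module.End.mem_eigenspace_iff.2 (hb a)))

/-- A sum of eigenvectors with eigenvalues `≥ ℓ` splits off its component with eigenvalue `ℓ`. -/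
theorem exists_eigen_add_of_mem_eigenFiltration {ℓ : ℝ} {w : W} (hw : w ∈ eigenFiltration T ℓ) :
    ∃ w₀ ∈ Module.End.eigenspace T ℓ, ∃ w₁ ∈ ⨆ (j : ℝ) (_ : ℓ < j), Module.End.eigenspace T j,
      w = w₀ + w₁ := by
  have : eigenFiltration T ℓ ≤ Module.End.eigenspace T ℓ ⊔
      ⨆ (j : ℝ) (_ : ℓ < j), Module.End.eigenspace T j := by
    refine iSup₂_le fun j hj => ?_
    rcases hj.eq_or_lt with rfl | hj
    · exact le_sup_left
    · exact le_sup_of_le_right (le_iSup₂_of_le j hj le_rfl)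
  obtain ⟨x, hx, y, hy, h⟩ := Submodule.mem_sup.1 (this hw)
  exact ⟨x, hx, y, hy, h.symm⟩

end Eigen

section Commutator

variable {V : Type*} [NormedAddCommGroup V] [NormedSpace ℝ V] [FiniteDimensional ℝ V]
  {T : V →L[ℝ] V}

/-- For diagonalizable `T`, an endomorphism preserves the filtration of `V` if and only if it is a
sum of eigenvectors of `[T, ·]` with eigenvalues `≥ 0`. -/
theorem mem_eigenFiltration_commutatorEnd_iff
    (hT : ⨆ c : ℝ, Module.End.eigenspace (T : V →ₗ[ℝ] V) c = ⊤) (A : V →L[ℝ] V) :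
    A ∈ eigenFiltration (commutatorEnd T) 0 ↔
      ∀ ℓ, ∀ v ∈ eigenFiltration (T : V →ₗ[ℝ] V) ℓ, A v ∈ eigenFiltration (T : V →ₗ[ℝ] V) ℓ := by
  classical
  constructor
  · intro hA ℓ v hv
    suffices h : eigenFiltration (commutatorEnd T) 0 ≤ (eigenFiltration (T : V →ₗ[ℝ] V) ℓ).comap
      (ContinuousLinearMap.apply ℝ V v : (V →L[ℝ] V) →ₗ[ℝ] V) from h hA
    refine iSup₂_le fun c hc B hB => ?_
    have hB' : ∀ w, T (B w) - B (T w) = c • B w := fun w =>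
      congrArg (fun L : V →L[ℝ] V => L w) (Module.End.mem_eigenspace_iff.1 hB)
    have : eigenFiltration (T : V →ₗ[ℝ] V) ℓ ≤
        (eigenFiltration (T : V →ₗ[ℝ] V) ℓ).comap (B : V →ₗ[ℝ] V) := by
      refine iSup₂_le fun j hj w hw => ?_
      refine eigenspace_le_eigenFiltration (j := j + c) (by linarith)
        (Module.End.mem_eigenspace_iff.2 ?_)
      have hw' : T w = j • w := Module.End.mem_eigenspace_iff.1 hw
      have := hB' w
      rw [hw', map_smul, sub_eq_iff_eq_add] at this
      simp only [ContinuousLinearMap.coe_coe]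
      rw [this, add_smul, add_comm]
    exact this hv
  · intro hA
    obtain ⟨n, b, μ, hb, -⟩ := exists_eigenbasis (S := Set.univ)
      (T := (T : V →ₗ[ℝ] V)) (by simpa using hT)
    -- the matrix units of the eigenbasis are eigenvectors of the commutator action
    let U : Fin n → Fin n → (V →L[ℝ] V) := fun a c =>
      (LinearMap.toContinuousLinearMap (b.coord c)).smulRight (b a)
    have hU : ∀ a c, U a c ∈ Module.End.eigenspace (commutatorEnd T) (μ a - μ c) := by
      intro a c
      rw [Module.End.mem_eigenspace_iff]
      ext v
      have h1 : b.repr (T v) c = μ c * b.repr v c := repr_apply_of_eigenbasis hb v c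
      have h2 : T (b a) = μ a • b a := hb a
      simp [commutatorEnd, U, h1, h2, smul_smul]
      rw [← sub_smul]
      ring_nf
    have hsum : A = ∑ c, ∑ a, b.repr (A (b c)) a • U a c := by
      ext v
      conv_lhs => rw [← b.sum_repr v]
      simp only [map_sum, map_smul, sum_apply, smul_apply]
      refine Finset.sum_congr rfl fun c _ => ?_
      conv_lhs => rw [← b.sum_repr (A (b c))]
      simp [U, Finset.smul_sum, smul_smul, mul_comm, -Module.Basis.sum_repr]
    rw [hsum]
    refine Submodule.sum_mem _ fun c _ => Submodule.sum_mem _ fun a _ => ?_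
    rcases lt_or_ge (μ a) (μ c) with h | h
    · have hc : b c ∈ eigenFiltration (T : V →ₗ[ℝ] V) (μ c) :=
        eigenspace_le_eigenFiltration le_rfl (Module.End.mem_eigenspace_iff.2 (hb c))
      rw [(mem_eigenFiltration_iff_repr hb).1 (hA _ _ hc) a h, zero_smul]
      exact zero_mem _
    · exact Submodule.smul_mem _ _ (eigenspace_le_eigenFiltration (by linarith) (hU a c))

end Commutator

/-! ### Parabolic subgroups preserve the filtrations of their representations -/

section Grading

variable {g : Type*} [LieRing g] [LieAlgebra ℝ g] [FiniteDimensional ℝ g]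

/-- In a graded Lie algebra with trivial centre, an automorphism which preserves the associated
filtration moves the grading element by an element of positive degree: the difference has degree
`≥ 0`, and its component of degree `0` is central, because both grading elements act on the
quotients of the filtration by the same scalars. -/
theorem sub_mem_eigenFiltration_one (hcenter : LieAlgebra.center ℝ g = ⊥) {D : g}
    (hD : ⨆ c ∈ Set.range ((↑) : ℤ → ℝ), Module.End.eigenspace (LieAlgebra.ad ℝ g D) c = ⊤)
    {φ φ' : g →ₗ[ℝ] g} (hφφ' : ∀ X, φ (φ' X) = X) (hφ : ∀ X Y, φ ⁅X, Y⁆ = ⁅φ X, φ Y⁆)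
    (hF : ∀ ℓ, ∀ X ∈ eigenFiltration (LieAlgebra.ad ℝ g D) ℓ,
      φ X ∈ eigenFiltration (LieAlgebra.ad ℝ g D) ℓ)
    (hF' : ∀ ℓ, ∀ X ∈ eigenFiltration (LieAlgebra.ad ℝ g D) ℓ,
      φ' X ∈ eigenFiltration (LieAlgebra.ad ℝ g D) ℓ) :
    φ D - D ∈ eigenFiltration (LieAlgebra.ad ℝ g D) 1 := by
  obtain ⟨n, b, μ, hb, hμ⟩ := exists_eigenbasis hD
  set T := LieAlgebra.ad ℝ g D with hTdef
  have hint : ∀ a c, μ a < μ c → μ a + 1 ≤ μ c := by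
    intro a c h
    obtain ⟨x, hx⟩ := hμ a
    obtain ⟨y, hy⟩ := hμ c
    rw [← hx, ← hy] at h ⊢
    exact_mod_cast h
  have hint0 : ∀ a, 0 < μ a → 1 ≤ μ a := by
    intro a h
    obtain ⟨x, hx⟩ := hμ a
    rw [← hx] at h ⊢
    exact_mod_cast h
  have hD0 : D ∈ eigenFiltration T 0 := eigenspace_le_eigenFiltration le_rfl
    (Module.End.mem_eigenspace_iff.2 (by simp [hTdef]))
  obtain ⟨Z₀, hZ₀, Z₁, hZ₁, hZ⟩ := exists_eigen_add_of_mem_eigenFiltration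
    (Submodule.sub_mem _ (hF 0 D hD0) hD0)
  have hpos : (⨆ (j : ℝ) (_ : 0 < j), Module.End.eigenspace T j) ≤ eigenFiltration T 1 := by
    refine iSup₂_le fun j hj w hw => (mem_eigenFiltration_iff_repr hb).2 fun a ha => ?_
    refine (mem_eigenspace_iff_repr hb).1 hw a fun h => ?_
    exact absurd (hint0 a (h ▸ hj)) (not_le.2 ha)
  have hZ₁' := hpos hZ₁
  have hlie : ∀ a, ∀ X ∈ eigenFiltration T 1, ⁅X, b a⁆ ∈ eigenFiltration T (μ a + 1) := by
    intro a X hX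
    have : eigenFiltration T 1 ≤ (eigenFiltration T (μ a + 1)).comap
        ((LieAlgebra.ad ℝ g : g →ₗ[ℝ] Module.End ℝ g).flip (b a)) := by
      refine iSup₂_le fun j hj w hw => ?_
      refine eigenspace_le_eigenFiltration (j := μ a + j) (by linarith)
        (Module.End.mem_eigenspace_iff.2 ?_)
      have h1 : ⁅D, w⁆ = j • w := Module.End.mem_eigenspace_iff.1 hw
      have h2 : ⁅D, b a⁆ = μ a • b a := hb a
      change ⁅D, ⁅w, b a⁆⁆ = (μ a + j) • ⁅w, b a⁆
      rw [leibniz_lie, h1, h2, smul_lie, lie_smul, add_smul, add_comm]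
    exact this hX
  have hcomm : ∀ a, ⁅Z₀, b a⁆ = 0 := by
    intro a
    have hba : b a ∈ eigenFiltration T (μ a) := eigenspace_le_eigenFiltration le_rfl
      (Module.End.mem_eigenspace_iff.2 (hb a))
    have h1 : T (φ' (b a)) - μ a • φ' (b a) ∈ eigenFiltration T (μ a + 1) := by
      refine (mem_eigenFiltration_iff_repr hb).2 fun c hc => ?_
      rw [map_sub, map_smul, Finsupp.sub_apply, Finsupp.smul_apply, repr_apply_of_eigenbasis hb,
        smul_eq_mul, ← sub_mul]
      rcases lt_trichotomy (μ c) (μ a) with h | h | h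
      · rw [(mem_eigenFiltration_iff_repr hb).1 (hF' _ _ hba) c h, mul_zero]
      · rw [h, sub_self, zero_mul]
      · exact absurd (hint a c h) (not_le.2 hc)
    have h2 : ⁅φ D - D, b a⁆ ∈ eigenFiltration T (μ a + 1) := by
      have e : ⁅φ D - D, b a⁆ = φ (T (φ' (b a)) - μ a • φ' (b a)) := by
        have h3 : ⁅D, b a⁆ = μ a • b a := hb a
        rw [sub_lie, h3, map_sub, map_smul, hφφ', hTdef, LieAlgebra.ad_apply, hφ, hφφ']
      rw [e]
      exact hF _ _ h1
    have h3 : ⁅Z₀, b a⁆ ∈ eigenFiltration T (μ a + 1) := by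
      have e : ⁅Z₀, b a⁆ = ⁅φ D - D, b a⁆ - ⁅Z₁, b a⁆ := by rw [hZ, add_lie, add_sub_cancel_right]
      rw [e]
      exact Submodule.sub_mem _ h2 (hlie a _ hZ₁')
    have h4 : ⁅Z₀, b a⁆ ∈ Module.End.eigenspace T (μ a) := by
      rw [Module.End.mem_eigenspace_iff]
      have h5 : ⁅D, Z₀⁆ = (0 : ℝ) • Z₀ := Module.End.mem_eigenspace_iff.1 hZ₀
      have h6 : ⁅D, b a⁆ = μ a • b a := hb a
      rw [hTdef, LieAlgebra.ad_apply, leibniz_lie, h5, h6, zero_smul, zero_lie, zero_add, lie_smul]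
    refine b.repr.injective (Finsupp.ext fun c => ?_)
    rw [map_zero, Finsupp.zero_apply]
    by_cases hc : μ c = μ a
    · exact (mem_eigenFiltration_iff_repr hb).1 h3 c (by linarith)
    · exact (mem_eigenspace_iff_repr hb).1 h4 c hc
  have hZ₀0 : Z₀ = 0 := by
    have had : LieAlgebra.ad ℝ g Z₀ = 0 := b.ext fun a => hcomm a
    have : Z₀ ∈ LieAlgebra.center ℝ g := by
      rw [LieModule.mem_maxTrivSubmodule]
      intro X
      rw [← lie_skew, ← LieAlgebra.ad_apply ℝ, had, LinearMap.zero_apply, neg_zero]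
    rwa [hcenter, LieSubmodule.mem_bot] at this
  rw [hZ, hZ₀0, zero_add]
  exact hZ₁'

end Grading

section Parabolic

variable {EG G EP P V : Type*}
  [NormedAddCommGroup EG] [NormedSpace ℝ EG] [FiniteDimensional ℝ EG]
  [TopologicalSpace G] [T2Space G] [ChartedSpace EG G] [Group G] [LieGroup 𝓘(ℝ, EG) ∞ G]
  [LieAlgebra.IsSemisimple ℝ (LieAlg EG G)]
  [NormedAddCommGroup EP] [NormedSpace ℝ EP] [FiniteDimensional ℝ EP]
  [TopologicalSpace P] [ChartedSpace EP P] [Group P] [LieGroup 𝓘(ℝ, EP) ∞ P]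
  [NormedAddCommGroup V] [NormedSpace ℝ V] [FiniteDimensional ℝ V]
  {j : P →* G} {E : LieAlg EP P}

instance lieAlg_finiteDimensional : FiniteDimensional ℝ (LieAlg EG G) :=
  inferInstanceAs (FiniteDimensional ℝ EG)

omit [T2Space G] [LieAlgebra.IsSemisimple ℝ (LieAlg EG G)] [FiniteDimensional ℝ EP]
  [LieGroup 𝓘(ℝ, EP) ∞ P] in
theorem IsParabolic.iSup_eigenspace_eq_top (hP : IsParabolic (EG := EG) EP j E) :
    ⨆ c ∈ Set.range ((↑) : ℤ → ℝ),
      Module.End.eigenspace (LieAlgebra.ad ℝ (LieAlg EG G) (tangentHom j E)) c = ⊤ := by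
  obtain ⟨k, hk⟩ := hP.grading
  rw [eq_top_iff, ← hk]
  exact iSup₂_le fun n _ => le_iSup₂_of_le (n : ℝ) ⟨n, rfl⟩ le_rfl

omit [FiniteDimensional ℝ EP] in
/-- An element of `P` moves the grading element by an element of positive degree. -/
theorem IsParabolic.Ad_sub_mem (hP : IsParabolic (EG := EG) EP j E) (p : P) :
    tangentHom (EB := EG) j (Ad p E - E) ∈
      eigenFiltration (LieAlgebra.ad ℝ (LieAlg EG G) (tangentHom j E)) 1 := by
  rw [map_sub, tangentHom_Ad hP.isClosedLieSubgroup.contMDiff]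
  refine sub_mem_eigenFiltration_one (φ := (Ad (EA := EG) (j p)).toLinearMap)
    (φ' := (Ad (EA := EG) (j p⁻¹)).toLinearMap) (LieAlgebra.center_eq_bot ℝ _)
    hP.iSup_eigenspace_eq_top (fun X => ?_) (fun X Y => Ad_lie _ _ _)
    (fun ℓ X hX => hP.ad_mem p ℓ X hX) (fun ℓ X hX => hP.ad_mem p⁻¹ ℓ X hX)
  simp only [ContinuousLinearMap.coe_coe]
  rw [← Ad_mul, ← map_mul, mul_inv_cancel, map_one, Ad_one]

omit [LieAlgebra.IsSemisimple ℝ (LieAlg EG G)] [FiniteDimensional ℝ V] in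
/-- Elements of `𝔭` of positive degree raise the filtration of a representation of `P`. -/
theorem IsParabolic.tangentRep_mem (hP : IsParabolic (EG := EG) EP j E)
    {lam : P →* (V →L[ℝ] V)} (hlam : ContMDiff 𝓘(ℝ, EP) 𝓘(ℝ, V →L[ℝ] V) ∞ lam)
    {Z : LieAlg EP P} (hZ : tangentHom (EB := EG) j Z ∈
      eigenFiltration (LieAlgebra.ad ℝ (LieAlg EG G) (tangentHom j E)) 1)
    {c : ℝ} {v : V} (hv : v ∈ Module.End.eigenspace (tangentRep lam E : V →ₗ[ℝ] V) c) :
    tangentRep lam Z v ∈ eigenFiltration (tangentRep lam E : V →ₗ[ℝ] V) (c + 1) := by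
  set D := tangentHom (EB := EG) j E with hDdef
  let N : Submodule ℝ (LieAlg EP P) := (eigenFiltration (tangentRep lam E : V →ₗ[ℝ] V) (c + 1)).comap
    ((ContinuousLinearMap.apply ℝ V v : (V →L[ℝ] V) →ₗ[ℝ] V) ∘ₗ (tangentRep lam).toLinearMap)
  have hj := hP.isClosedLieSubgroup.injective_tangentHom
  suffices h : eigenFiltration (LieAlgebra.ad ℝ (LieAlg EG G) D) 1 ≤
      N.map (tangentHom (EB := EG) j).toLinearMap by
    obtain ⟨Z', hZ', h⟩ := h hZ
    rw [← hj h]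
    exact hZ'
  obtain ⟨n, b, μ, hb, hμ⟩ := exists_eigenbasis hP.iSup_eigenspace_eq_top
  have hsub : eigenFiltration (LieAlgebra.ad ℝ (LieAlg EG G) D) 1 ≤ subAlg EP EG j := by
    intro X hX
    rw [hP.lieAlg_eq, ← b.sum_repr X]
    refine Submodule.sum_mem _ fun a _ => ?_
    rcases lt_or_ge (μ a) 1 with ha | ha
    · rw [(mem_eigenFiltration_iff_repr hb).1 hX a ha, zero_smul]; exact zero_mem _
    · obtain ⟨m, hm⟩ := hμ a
      refine Submodule.smul_mem _ _ ((le_iSup₂_of_le (f := fun (n : ℤ) (_ : 0 ≤ n) =>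
        gradeSpace (tangentHom (EB := EG) j E) n) m ?_ le_rfl) ?_)
      · have : (0 : ℝ) ≤ m := by rw [hm]; linarith
        exact_mod_cast this
      · rw [gradeSpace, hm]
        exact Module.End.mem_eigenspace_iff.2 (hb a)
  refine iSup₂_le fun d hd X hX => ?_
  obtain ⟨Z', rfl⟩ := hsub (eigenspace_le_eigenFiltration hd hX)
  refine ⟨Z', eigenspace_le_eigenFiltration (j := c + d) (by linarith)
    (Module.End.mem_eigenspace_iff.2 ?_), rfl⟩
  have h1 : ⁅E, Z'⁆ = d • Z' := by
    refine hj ?_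
    rw [tangentHom_lie hP.isClosedLieSubgroup.contMDiff, map_smul]
    exact Module.End.mem_eigenspace_iff.1 hX
  have h2 := congrArg (fun L : V →L[ℝ] V => L v) (tangentRep_lie hlam E Z')
  have h3 : tangentRep lam E v = c • v := Module.End.mem_eigenspace_iff.1 hv
  rw [h1, map_smul] at h2
  simp only [mul_apply_eq_comp, sub_apply, smul_apply, h3, map_smul] at h2
  change tangentRep lam E (tangentRep lam Z' v) = (c + d) • tangentRep lam Z' v
  rw [add_smul, h2, add_sub_cancel]

/-- A parabolic subgroup preserves the filtration of a representation by the eigenvalues of the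
grading element. -/
theorem IsParabolic.rep_mem_eigenFiltration (hP : IsParabolic (EG := EG) EP j E)
    {lam : P →* (V →L[ℝ] V)} (hlam : ContMDiff 𝓘(ℝ, EP) 𝓘(ℝ, V →L[ℝ] V) ∞ lam)
    (hT : ⨆ c : ℝ, Module.End.eigenspace (tangentRep lam E : V →ₗ[ℝ] V) c = ⊤)
    (p : P) (ℓ : ℝ) (v : V) (hv : v ∈ eigenFiltration (tangentRep lam E : V →ₗ[ℝ] V) ℓ) :
    lam p v ∈ eigenFiltration (tangentRep lam E : V →ₗ[ℝ] V) ℓ := by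
  obtain ⟨n, b, μ, hb, -⟩ := exists_eigenbasis (S := Set.univ)
    (T := (tangentRep lam E : V →ₗ[ℝ] V)) (by simpa using hT)
  set T := tangentRep lam E with hTdef
  obtain ⟨M, hM⟩ : ∃ M, ∀ a, μ a < M := by
    obtain ⟨M, hM⟩ := (Set.finite_range μ).bddAbove
    exact ⟨M + 1, fun a => (hM ⟨a, rfl⟩).trans_lt (lt_add_one M)⟩
  have hTp : ∀ w, T (lam p w) = lam p (T w) + lam p (tangentRep lam (Ad p⁻¹ E - E) w) := by
    intro w
    have h := congrArg (fun L : V →L[ℝ] V => lam p (L w)) (tangentRep_Ad hlam p⁻¹ E)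
    have hpp : ∀ u, lam p (lam p⁻¹ u) = u := fun u => by
      rw [← mul_apply_eq_comp, ← map_mul, mul_inv_cancel, map_one]; rfl
    simp only [mul_apply_eq_comp, hpp, inv_inv] at h
    rw [map_sub, sub_apply, map_sub, h, ← hTdef]
    abel
  -- induction on the filtration, from above
  have key : ∀ (m : ℕ) (ℓ : ℝ), M - m ≤ ℓ → ∀ v ∈ eigenFiltration (T : V →ₗ[ℝ] V) ℓ,
      lam p v ∈ eigenFiltration (T : V →ₗ[ℝ] V) ℓ := by
    intro m
    induction m with
    | zero =>
      intro ℓ hℓ v hv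
      have : v = 0 := b.repr.injective (Finsupp.ext fun a => by
        rw [map_zero, Finsupp.zero_apply]
        exact (mem_eigenFiltration_iff_repr hb).1 hv a ((hM a).trans_le (by simpa using hℓ)))
      rw [this, map_zero]
      exact zero_mem _
    | succ m ih =>
      intro ℓ hℓ v hv
      push_cast at hℓ
      have : eigenFiltration (T : V →ₗ[ℝ] V) ℓ ≤
          (eigenFiltration (T : V →ₗ[ℝ] V) ℓ).comap (lam p : V →ₗ[ℝ] V) := by
        refine iSup₂_le fun c hc w hw => (mem_eigenFiltration_iff_repr hb).2 fun a ha => ?_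
        have h1 := ih (c + 1) (by linarith) _ (hP.tangentRep_mem hlam (hP.Ad_sub_mem p⁻¹) hw)
        have hw' : T w = c • w := Module.End.mem_eigenspace_iff.1 hw
        have h2 : lam p (tangentRep lam (Ad p⁻¹ E - E) w) = T (lam p w) - c • lam p w := by
          rw [hTp, hw', map_smul, add_sub_cancel_left]
        have h3 : b.repr (T (lam p w)) a = μ a * b.repr (lam p w) a :=
          repr_apply_of_eigenbasis hb _ a
        have h4 := (mem_eigenFiltration_iff_repr hb).1 h1 a (by linarith)
        rw [h2, map_sub, map_smul, Finsupp.sub_apply, Finsupp.smul_apply, h3, smul_eq_mul,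
          ← sub_mul, mul_eq_zero] at h4
        exact h4.resolve_left (by linarith)
      exact this hv
  obtain ⟨m, hm⟩ := exists_nat_ge (M - ℓ)
  exact key m ℓ (by linarith) v hv

end Parabolic

/-! ### Smooth dependence of integrals on parameters -/

section ParametricIntegral

open MeasureTheory

variable {E EH H F : Type*}
  [NormedAddCommGroup E] [NormedSpace ℝ E] [FiniteDimensional ℝ E]
  [NormedAddCommGroup EH] [NormedSpace ℝ EH]
  [TopologicalSpace H] [T2Space H] [ChartedSpace EH H]
  [IsManifold 𝓘(ℝ, EH) 1 H] [MeasurableSpace H] [BorelSpace H]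
  [NormedAddCommGroup F] [NormedSpace ℝ F]
  {μ : Measure H} [IsFiniteMeasureOnCompacts μ]
  {U : Set E} {g : E × H → F} {C : Set H}

omit [FiniteDimensional ℝ E] [T2Space H] [MeasurableSpace H] [BorelSpace H] in
theorem contMDiffOn_fderiv_fst (hU : IsOpen U)
    (hg : ContMDiffOn (𝓘(ℝ, E).prod 𝓘(ℝ, EH)) 𝓘(ℝ, F) ∞ g (U ×ˢ Set.univ)) :
    ContMDiffOn (𝓘(ℝ, E).prod 𝓘(ℝ, EH)) 𝓘(ℝ, E →L[ℝ] F) ∞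
      (fun p => fderiv ℝ (fun y => g (y, p.2)) p.1) (U ×ˢ Set.univ) := by
  rintro ⟨x, h⟩ ⟨hx, -⟩
  refine ContMDiffAt.contMDiffWithinAt ?_
  have hgx : ContMDiffAt (𝓘(ℝ, E).prod 𝓘(ℝ, EH)) 𝓘(ℝ, F) ∞ g (x, h) :=
    hg.contMDiffAt ((hU.prod isOpen_univ).mem_nhds ⟨hx, trivial⟩)
  have h1 : ContMDiffAt ((𝓘(ℝ, E).prod 𝓘(ℝ, EH)).prod 𝓘(ℝ, E)) 𝓘(ℝ, F) ∞
      (Function.uncurry fun (p : E × H) (y : E) => g (y, p.2)) ((x, h), x) :=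
    ContMDiffAt.comp (f := fun q : (E × H) × E => (q.2, q.1.2)) ((x, h), x) hgx
      (contMDiffAt_snd.prodMk (contMDiffAt_snd.comp _ contMDiffAt_fst))
  have h2 := contMDiffAt_flatDeriv_space (J := 𝓘(ℝ, E).prod 𝓘(ℝ, EH)) (g := Prod.fst) h1 contMDiffAt_fst
  simpa only [flatDeriv_eq_fderiv] using h2

theorem hasFDerivAt_setIntegral (hU : IsOpen U) (hC : IsCompact C)
    (hg : ContMDiffOn (𝓘(ℝ, E).prod 𝓘(ℝ, EH)) 𝓘(ℝ, F) ∞ g (U ×ˢ Set.univ)) {x : E} (hx : x ∈ U) :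
    IntegrableOn (fun h => fderiv ℝ (fun y => g (y, h)) x) C μ ∧
    HasFDerivAt (fun y => ∫ h in C, g (y, h) ∂μ)
      (∫ h in C, fderiv ℝ (fun y => g (y, h)) x ∂μ) x := by
  have hslice : ∀ y ∈ U, Continuous (fun h => g (y, h)) := fun y hy =>
    hg.continuousOn.comp_continuous (by fun_prop) fun h => ⟨hy, trivial⟩
  have hF' := (contMDiffOn_fderiv_fst hU hg).continuousOn
  have hslice' : ∀ y ∈ U, Continuous (fun h => fderiv ℝ (fun y => g (y, h)) y) := fun y hy =>
    hF'.comp_continuous (f := fun h => (y, h)) (by fun_prop) fun h => ⟨hy, trivial⟩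
  obtain ⟨r, hr, hball⟩ := Metric.nhds_basis_closedBall.mem_iff.1 (hU.mem_nhds hx)
  obtain ⟨M, hM⟩ := ((isCompact_closedBall x r).prod hC).exists_bound_of_continuousOn
    (hF'.mono (Set.prod_mono hball (Set.subset_univ _)))
  have hint : ∀ y ∈ U, IntegrableOn (fun h => g (y, h)) C μ := fun y hy =>
    (hslice y hy).continuousOn.integrableOn_compact hC
  refine ⟨(hslice' x hx).continuousOn.integrableOn_compact hC, ?_⟩
  refine hasFDerivAt_integral_of_dominated_of_fderiv_le (F := fun y h => g (y, h))
    (F' := fun y h => fderiv ℝ (fun y => g (y, h)) y) (bound := fun _ => M)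
    (Metric.ball_mem_nhds x hr) ?_ (hint x hx)
    ((hslice' x hx).continuousOn.integrableOn_compact hC).aestronglyMeasurable ?_
    (integrableOn_const hC.measure_lt_top.ne) ?_
  · filter_upwards [hU.mem_nhds hx] with y hy using (hint y hy).aestronglyMeasurable
  · filter_upwards [ae_restrict_mem hC.measurableSet] with h hh y hy
    exact hM (y, h) ⟨Metric.ball_subset_closedBall hy, hh⟩
  · refine Filter.Eventually.of_forall fun h y hy => ?_
    have hyU := hball (Metric.ball_subset_closedBall hy)
    have h1 : ContMDiffAt 𝓘(ℝ, E) 𝓘(ℝ, F) ∞ (fun y => g (y, h)) y :=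
      ContMDiffAt.comp (f := fun z : E => (z, h)) y
        (hg.contMDiffAt ((hU.prod isOpen_univ).mem_nhds ⟨hyU, trivial⟩))
        (contMDiffAt_id.prodMk contMDiffAt_const)
    exact (h1.contDiffAt.differentiableAt (by simp)).hasFDerivAt

/-- The integral over a compact set of a smooth family of functions depends smoothly on the
parameter. -/
theorem contDiffOn_setIntegral (hU : IsOpen U) (hC : IsCompact C)
    (hg : ContMDiffOn (𝓘(ℝ, E).prod 𝓘(ℝ, EH)) 𝓘(ℝ, F) ∞ g (U ×ˢ Set.univ)) :
    ContDiffOn ℝ ∞ (fun x => ∫ h in C, g (x, h) ∂μ) U := by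
  rw [contDiffOn_infty]
  intro n
  induction n generalizing g with
  | zero =>
    exact contDiffOn_zero.2 fun x hx =>
      (hasFDerivAt_setIntegral hU hC hg hx).2.continuousAt.continuousWithinAt
  | succ n ih =>
    push_cast
    rw [contDiffOn_succ_iff_fderiv_apply hU.uniqueDiffOn]
    refine ⟨fun x hx => (hasFDerivAt_setIntegral hU hC hg
      hx).2.differentiableAt.differentiableWithinAt, by simp, fun v => ?_⟩
    have h1 := ih (g := fun p => fderiv ℝ (fun y => g (y, p.2)) p.1 v)
      ((contMDiffOn_fderiv_fst hU hg).clm_apply contMDiffOn_const)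
    refine h1.congr fun x hx => ?_
    obtain ⟨hi, hd⟩ := hasFDerivAt_setIntegral (μ := μ) hU hC hg hx
    rw [fderivWithin_of_isOpen hU hx, hd.fderiv, ContinuousLinearMap.integral_apply hi]

end ParametricIntegral

/-! ### Sections obtained by averaging over the subgroup -/

section Average

open MeasureTheory Topology

variable {EK K EH H F : Type*}
  [NormedAddCommGroup EK] [NormedSpace ℝ EK] [FiniteDimensional ℝ EK]
  [TopologicalSpace K] [T2Space K] [ChartedSpace EK K] [Group K] [LieGroup 𝓘(ℝ, EK) ∞ K]
  [NormedAddCommGroup EH] [NormedSpace ℝ EH]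
  [TopologicalSpace H] [ChartedSpace EH H] [Group H] [LieGroup 𝓘(ℝ, EH) ∞ H]
  [NormedAddCommGroup F] [NormedSpace ℝ F]
  [MeasurableSpace H] [BorelSpace H] {μ : Measure H}

/-- The average `k ↦ ∫ ρ(h) u(kh) dh` over the subgroup `ι : H → K` of a function `u`. -/
def average (μ : Measure H) (ι : H →* K) (ρ : H →* (F →L[ℝ] F)) (u : K → F) (k : K) : F :=
  ∫ h, ρ h (u (k * ι h)) ∂μ

variable {ι : H →* K} {ρ : H →* (F →L[ℝ] F)} {u : K → F}

omit [FiniteDimensional ℝ EK] [T2Space K]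
  [LieGroup 𝓘(ℝ, EH) ∞ H] [MeasurableSpace H] [BorelSpace H] in
theorem continuous_averageIntegrand (hι : IsClosedLieSubgroup EH EK ι)
    (hρ : ContMDiff 𝓘(ℝ, EH) 𝓘(ℝ, F →L[ℝ] F) ∞ ρ) (hu : Continuous u) (k : K) :
    Continuous fun h => ρ h (u (k * ι h)) := by
  have : IsTopologicalGroup K := topologicalGroup_of_lieGroup 𝓘(ℝ, EK) ∞
  exact hρ.continuous.clm_apply
    (hu.comp (continuous_const.mul hι.contMDiff.continuous))

omit [FiniteDimensional ℝ EK] [T2Space K]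
  [LieGroup 𝓘(ℝ, EH) ∞ H] [MeasurableSpace H] [BorelSpace H] in
theorem hasCompactSupport_averageIntegrand (hι : IsClosedLieSubgroup EH EK ι)
    (hu : HasCompactSupport u) (k : K) :
    HasCompactSupport fun h => ρ h (u (k * ι h)) := by
  have : IsTopologicalGroup K := topologicalGroup_of_lieGroup 𝓘(ℝ, EK) ∞
  have h1 : HasCompactSupport fun h => u (k * ι h) :=
    hu.comp_isClosedEmbedding ((Homeomorph.mulLeft k).isClosedEmbedding.comp hι.isClosedEmbedding)
  refine h1.mono fun h hh => ?_
  simp only [Function.mem_support] at hh ⊢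
  exact fun h0 => hh (by rw [h0, map_zero])

variable [IsFiniteMeasureOnCompacts μ]

omit [FiniteDimensional ℝ EK] [T2Space K]
  [LieGroup 𝓘(ℝ, EH) ∞ H] in
theorem integrable_averageIntegrand (hι : IsClosedLieSubgroup EH EK ι)
    (hρ : ContMDiff 𝓘(ℝ, EH) 𝓘(ℝ, F →L[ℝ] F) ∞ ρ) (hu : Continuous u) (hu' : HasCompactSupport u)
    (k : K) : Integrable (fun h => ρ h (u (k * ι h))) μ :=
  (continuous_averageIntegrand hι hρ hu k).integrable_of_hasCompactSupport
    (hasCompactSupport_averageIntegrand hι hu' k)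

open scoped Pointwise in
theorem contMDiff_average (hι : IsClosedLieSubgroup EH EK ι)
    (hρ : ContMDiff 𝓘(ℝ, EH) 𝓘(ℝ, F →L[ℝ] F) ∞ ρ) (hu : ContMDiff 𝓘(ℝ, EK) 𝓘(ℝ, F) ∞ u)
    (hu' : HasCompactSupport u) :
    ContMDiff 𝓘(ℝ, EK) 𝓘(ℝ, F) ∞ (average μ ι ρ u) := by
  have : IsTopologicalGroup K := topologicalGroup_of_lieGroup 𝓘(ℝ, EK) ∞
  have : LocallyCompactSpace K := Manifold.locallyCompact_of_finiteDimensional 𝓘(ℝ, EK)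
  have : T2Space H := hι.isClosedEmbedding.isEmbedding.t2Space
  have : IsManifold 𝓘(ℝ, EH) 1 H := IsManifold.of_le (n := ∞) (by simp)
  intro k₀
  obtain ⟨N, hN, hk₀⟩ := exists_compact_mem_nhds k₀
  -- for `k` near `k₀`, only elements of the compact set `C` contribute to the integral
  set C : Set H := ι ⁻¹' (N⁻¹ * tsupport u)
  have hC : IsCompact C :=
    hι.isClosedEmbedding.isCompact_preimage (hN.inv.mul hu')
  have hCint : ∀ k ∈ N, average μ ι ρ u k = ∫ h in C, ρ h (u (k * ι h)) ∂μ := by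
    intro k hk
    refine (setIntegral_eq_integral_of_forall_compl_eq_zero fun h hh => ?_).symm
    have : u (k * ι h) = 0 := by
      by_contra h0
      refine hh (Set.mem_mul.2 ⟨k⁻¹, Set.inv_mem_inv.2 hk, k * ι h, subset_tsupport _ h0, ?_⟩)
      group
    rw [this, map_zero]
  set e := extChartAt 𝓘(ℝ, EK) k₀
  have hsmooth : ContDiffOn ℝ ∞ (fun x => ∫ h in C, ρ h (u (e.symm x * ι h)) ∂μ) e.target := by
    refine contDiffOn_setIntegral (EH := EH) (g := fun p : EK × H => ρ p.2 (u (e.symm p.1 * ι p.2)))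
      (isOpen_extChartAt_target k₀) hC ?_
    have h1 : ContMDiffOn (𝓘(ℝ, EK).prod 𝓘(ℝ, EH)) 𝓘(ℝ, EK) ∞
        (fun p : EK × H => e.symm p.1) (e.target ×ˢ Set.univ) :=
      (contMDiffOn_extChartAt_symm k₀).comp contMDiffOn_fst fun p hp => hp.1
    have h2 : ContMDiffOn (𝓘(ℝ, EK).prod 𝓘(ℝ, EH)) 𝓘(ℝ, EK) ∞
        (fun p : EK × H => ι p.2) (e.target ×ˢ Set.univ) :=
      hι.contMDiff.comp_contMDiffOn contMDiffOn_snd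
    exact ContMDiffOn.clm_apply (hρ.comp_contMDiffOn contMDiffOn_snd)
      (hu.comp_contMDiffOn (h1.mul h2))
  have h3 : ContMDiffAt 𝓘(ℝ, EK) 𝓘(ℝ, F) ∞
      (fun k => ∫ h in C, ρ h (u (e.symm (e k) * ι h)) ∂μ) k₀ :=
    ContMDiffAt.comp (I' := 𝓘(ℝ, EK)) (f := e)
      (g := fun x => ∫ h in C, ρ h (u (e.symm x * ι h)) ∂μ) k₀
      ((hsmooth.contDiffAt (extChartAt_target_mem_nhds k₀)).contMDiffAt) contMDiffAt_extChartAt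
  refine h3.congr_of_eventuallyEq ?_
  filter_upwards [hk₀, extChartAt_source_mem_nhds (I := 𝓘(ℝ, EK)) k₀] with k hk hk'
  rw [hCint k hk, e.left_inv hk']

/-- Left invariance of the measure makes the average equivariant. -/
theorem average_mem_sections [CompleteSpace F] [μ.IsMulLeftInvariant]
    (hι : IsClosedLieSubgroup EH EK ι)
    (hρ : ContMDiff 𝓘(ℝ, EH) 𝓘(ℝ, F →L[ℝ] F) ∞ ρ) (hu : ContMDiff 𝓘(ℝ, EK) 𝓘(ℝ, F) ∞ u)
    (hu' : HasCompactSupport u) : average μ ι ρ u ∈ sections EK ι ρ := by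
  have : IsTopologicalGroup H := topologicalGroup_of_lieGroup 𝓘(ℝ, EH) ∞
  refine ⟨contMDiff_average hι hρ hu hu', fun k h₀ => ?_⟩
  have h1 := integral_mul_left_eq_self (μ := μ) (fun h => ρ h₀⁻¹ (ρ h (u (k * ι h)))) h₀
  rw [ContinuousLinearMap.integral_comp_comm _
    (integrable_averageIntegrand hι hρ hu.continuous hu' k)] at h1
  refine Eq.trans ?_ h1
  refine integral_congr_ae (Filter.Eventually.of_forall fun h => ?_)
  simp only [map_mul ι, ← mul_assoc]
  rw [← mul_apply_eq_comp, ← map_mul, inv_mul_cancel_left]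

end Average

section Sections

open MeasureTheory Topology

variable {EK K EH H V : Type*}
  [NormedAddCommGroup EK] [NormedSpace ℝ EK] [FiniteDimensional ℝ EK]
  [TopologicalSpace K] [T2Space K] [ChartedSpace EK K] [Group K] [LieGroup 𝓘(ℝ, EK) ∞ K]
  [NormedAddCommGroup EH] [NormedSpace ℝ EH] [FiniteDimensional ℝ EH]
  [TopologicalSpace H] [ChartedSpace EH H] [Group H] [LieGroup 𝓘(ℝ, EH) ∞ H]
  [NormedAddCommGroup V] [NormedSpace ℝ V] [FiniteDimensional ℝ V]
  {ι : H →* K} {ρ : H →* (V →L[ℝ] V)}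

/-- A subspace of a finite-dimensional space is the fixed space of a continuous linear map. -/
theorem exists_clm_fixed_iff (S : Submodule ℝ V) : ∃ p : V →L[ℝ] V, ∀ v, v ∈ S ↔ p v = v := by
  obtain ⟨q, hq⟩ := S.subtype.exists_leftInverse_of_injective (Submodule.ker_subtype S)
  refine ⟨LinearMap.toContinuousLinearMap (S.subtype ∘ₗ q), fun v => ⟨fun hv => ?_, fun hv => ?_⟩⟩
  · exact congrArg Subtype.val (LinearMap.congr_fun hq ⟨v, hv⟩)
  · rw [← hv]; exact (q v).2

/-- Let `S ⊆ V` be a subspace stable under `H`. Every element of `S` is the value at the base point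
of a section with values in `S`: otherwise some linear form vanishing on all these values is
positive on `v`, and averaging a multiple of `v` concentrated near the identity gives a
contradiction. -/
theorem exists_section_eq (hι : IsClosedLieSubgroup EH EK ι)
    (hρ : ContMDiff 𝓘(ℝ, EH) 𝓘(ℝ, V →L[ℝ] V) ∞ ρ) (S : Submodule ℝ V)
    (hS : ∀ h, ∀ v ∈ S, ρ h v ∈ S) {v : V} (hv : v ∈ S) :
    ∃ s : sections EK ι ρ, s.1 1 = v ∧ ∀ k, s.1 k ∈ S := by
  have : IsTopologicalGroup H := topologicalGroup_of_lieGroup 𝓘(ℝ, EH) ∞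
  have : LocallyCompactSpace H := Manifold.locallyCompact_of_finiteDimensional 𝓘(ℝ, EH)
  let _ : MeasurableSpace H := borel H
  have : BorelSpace H := ⟨rfl⟩
  let μ : Measure H := Measure.haar
  let N : Submodule ℝ (sections EK ι ρ) :=
    { carrier := {s | ∀ k, s.1 k ∈ S}
      add_mem' := fun hs ht k => S.add_mem (hs k) (ht k)
      zero_mem' := fun k => S.zero_mem
      smul_mem' := fun c s hs k => S.smul_mem c (hs k) }
  let ev : sections EK ι ρ →ₗ[ℝ] V := LinearMap.proj 1 ∘ₗ (sections EK ι ρ).subtype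
  by_contra hcon
  have hvN : v ∉ N.map ev := by
    rintro ⟨s, hs, rfl⟩
    exact hcon ⟨s, rfl, hs⟩
  obtain ⟨L₀, hL₀v, hL₀⟩ := Submodule.exists_le_ker_of_notMem hvN
  let L : V →L[ℝ] ℝ := LinearMap.toContinuousLinearMap ((L₀ v)⁻¹ • L₀)
  have hLv : L v = 1 := inv_mul_cancel₀ hL₀v
  have hL : ∀ s : sections EK ι ρ, (∀ k, s.1 k ∈ S) → L (s.1 1) = 0 := by
    intro s hs
    have : L₀ (s.1 1) = 0 := hL₀ (Submodule.mem_map_of_mem (f := ev) (show s ∈ N from hs))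
    change (L₀ v)⁻¹ * L₀ (s.1 1) = 0
    rw [this, mul_zero]
  have hcont : Continuous fun h => L (ρ h v) :=
    L.continuous.comp (hρ.continuous.clm_apply continuous_const)
  have hnear : {h | 0 < L (ρ h v)} ∈ 𝓝 (1 : H) := by
    refine (isOpen_lt continuous_const hcont).mem_nhds ?_
    simp [hLv]
  rw [hι.isClosedEmbedding.isEmbedding.nhds_eq_comap, map_one, Filter.mem_comap] at hnear
  obtain ⟨O, hO, hOsub⟩ := hnear
  obtain ⟨χ, -, hχ⟩ := (SmoothBumpFunction.nhds_basis_tsupport (I := 𝓘(ℝ, EK)) (1 : K)).mem_iff.1 hO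
  have hu : ContMDiff 𝓘(ℝ, EK) 𝓘(ℝ, V) ∞ fun k => χ k • v := χ.contMDiff.smul contMDiff_const
  have hu' : HasCompactSupport fun k => χ k • v := χ.hasCompactSupport.smul_right
  let s : sections EK ι ρ := ⟨_, average_mem_sections (μ := μ) hι hρ hu hu'⟩
  have hint := fun k => integrable_averageIntegrand (μ := μ) hι hρ hu.continuous hu' k
  have hs : ∀ k, s.1 k ∈ S := by
    obtain ⟨p, hp⟩ := exists_clm_fixed_iff S
    intro k
    rw [hp]
    refine (p.integral_comp_comm (hint k)).symm.trans
      (integral_congr_ae (Filter.Eventually.of_forall fun h => ?_))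
    exact (hp _).1 (hS h _ (S.smul_mem _ hv))
  have h0 : ∫ h, L (ρ h (χ (1 * ι h) • v)) ∂μ = 0 :=
    (L.integral_comp_comm (hint 1)).trans (hL s hs)
  refine absurd h0 (ne_of_gt ?_)
  refine Continuous.integral_pos_of_hasCompactSupport_nonneg_nonzero
    (L.continuous.comp (continuous_averageIntegrand hι hρ hu.continuous 1))
    ((hasCompactSupport_averageIntegrand hι hu' 1).comp_left (map_zero L)) (fun h => ?_) (x := 1) ?_
  · simp only [one_mul, map_smul, smul_eq_mul, Pi.zero_apply]
    by_cases hh : ι h ∈ tsupport χ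
    · exact mul_nonneg χ.nonneg (hOsub (hχ hh)).le
    · rw [image_eq_zero_of_notMem_tsupport hh, zero_mul]
  · simp [hLv]

/-- A linear choice of sections with prescribed values at the base point. -/
theorem exists_linear_section (hι : IsClosedLieSubgroup EH EK ι)
    (hρ : ContMDiff 𝓘(ℝ, EH) 𝓘(ℝ, V →L[ℝ] V) ∞ ρ) :
    ∃ σ : V →ₗ[ℝ] sections EK ι ρ, ∀ v, (σ v).1 1 = v := by
  let ev : sections EK ι ρ →ₗ[ℝ] V := LinearMap.proj 1 ∘ₗ (sections EK ι ρ).subtype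
  obtain ⟨σ, hσ⟩ := ev.exists_rightInverse_of_surjective (LinearMap.range_eq_top.2 fun v => by
    obtain ⟨s, hs, -⟩ := exists_section_eq hι hρ ⊤ (fun _ _ _ => trivial) (v := v) trivial
    exact ⟨s, hs⟩)
  exact ⟨σ, fun v => LinearMap.congr_fun hσ v⟩

end Sections

/-! ### Invariant connections -/

section Frame

open MeasureTheory Topology

variable {EK K EH H V : Type*}
  [NormedAddCommGroup EK] [NormedSpace ℝ EK] [FiniteDimensional ℝ EK]
  [TopologicalSpace K] [T2Space K] [ChartedSpace EK K] [Group K] [LieGroup 𝓘(ℝ, EK) ∞ K]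
  [NormedAddCommGroup EH] [NormedSpace ℝ EH] [FiniteDimensional ℝ EH]
  [TopologicalSpace H] [ChartedSpace EH H] [Group H] [LieGroup 𝓘(ℝ, EH) ∞ H]
  [NormedAddCommGroup V] [NormedSpace ℝ V] [FiniteDimensional ℝ V]
  {ι : H →* K} {ρ : H →* (V →L[ℝ] V)}

/-- A section `s` which vanishes at the base point is, up to a cut-off function `χ`, a combination
`∑ f_a s_a` of sections with coefficients `f_a` vanishing at the base point. The `s_a` form a
frame near the base point, and `χ` and the `f_a` are averages of a bump function `u` and of `u`
times the coefficients of `s` in the frame. -/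
theorem exists_cutoff_expansion (hι : IsClosedLieSubgroup EH EK ι)
    (hρ : ContMDiff 𝓘(ℝ, EH) 𝓘(ℝ, V →L[ℝ] V) ∞ ρ) (s : sections EK ι ρ) (hs : s.1 1 = 0) :
    ∃ χ : baseFunctions EK ι, χ.1 1 ≠ 0 ∧ ∃ (n : ℕ) (f : Fin n → baseFunctions EK ι)
      (t : Fin n → sections EK ι ρ), (∀ a, (f a).1 1 = 0) ∧
        mulSection χ s = ∑ a, mulSection (f a) (t a) := by
  have : IsTopologicalGroup H := topologicalGroup_of_lieGroup 𝓘(ℝ, EH) ∞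
  have : LocallyCompactSpace H := Manifold.locallyCompact_of_finiteDimensional 𝓘(ℝ, EH)
  let _ : MeasurableSpace H := borel H
  have : BorelSpace H := ⟨rfl⟩
  let μ : Measure H := Measure.haar
  obtain ⟨σ, hσ⟩ := exists_linear_section (EK := EK) hι hρ
  let b := Module.finBasis ℝ V
  -- the frame given by the sections `σ (b a)`, as a function with values in the endomorphisms
  let S : K → V →L[ℝ] V := fun k =>
    LinearMap.toContinuousLinearMap (LinearMap.proj k ∘ₗ (sections EK ι ρ).subtype ∘ₗ σ)
  have hSapp : ∀ k v, S k v = (σ v).1 k := fun k v => rfl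
  have hSsum : S = fun k => ∑ a, (LinearMap.toContinuousLinearMap (b.coord a)).smulRight
      ((σ (b a)).1 k) := by
    funext k
    ext v
    conv_lhs => rw [← b.sum_repr v]
    simp [hSapp, -Module.Basis.sum_repr]
  have hSsmooth : ContMDiff 𝓘(ℝ, EK) 𝓘(ℝ, V →L[ℝ] V) ∞ S := by
    rw [hSsum]
    refine contMDiff_finsetSum fun a _ => ?_
    exact (ContinuousLinearMap.smulRightL ℝ V V
      (LinearMap.toContinuousLinearMap (b.coord a))).contMDiff.comp (σ (b a)).2.1
  have hS1 : S 1 = 1 := by ext v; exact hσ v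
  have hSeq : ∀ k h, S (k * ι h) = ρ h⁻¹ * S k := fun k h => by
    ext v; exact (σ v).2.2 k h
  have hρinv : ∀ h v, ρ h (ρ h⁻¹ v) = v := fun h v => by
    rw [← mul_apply_eq_comp, ← map_mul, mul_inv_cancel, map_one]; rfl
  -- a bump function supported where the frame is invertible
  have hO : {k | IsUnit (S k)} ∈ 𝓝 (1 : K) :=
    (Units.isOpen.preimage hSsmooth.continuous).mem_nhds (by simp [hS1])
  obtain ⟨u, -, hu⟩ := (SmoothBumpFunction.nhds_basis_tsupport (I := 𝓘(ℝ, EK)) (1 : K)).mem_iff.1 hO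
  let q : K → V := fun k => u k • Ring.inverse (S k) (s.1 k)
  have hq : ContMDiff 𝓘(ℝ, EK) 𝓘(ℝ, V) ∞ q := by
    refine contMDiff_of_tsupport fun k hk => ?_
    obtain ⟨w, hw⟩ : IsUnit (S k) := hu (tsupport_smul_subset_left _ _ hk)
    have h1 : ContMDiffAt 𝓘(ℝ, EK) 𝓘(ℝ, V →L[ℝ] V) ∞ (fun k => Ring.inverse (S k)) k := by
      have h2 : ContDiffAt ℝ ∞ Ring.inverse (S k) := hw ▸ contDiffAt_ringInverse ℝ w
      exact h2.contMDiffAt.comp k hSsmooth.contMDiffAt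
    exact u.contMDiff.contMDiffAt.smul (h1.clm_apply s.2.1.contMDiffAt)
  have hq' : HasCompactSupport q := u.hasCompactSupport.smul_right
  let Q := average μ ι (1 : H →* (V →L[ℝ] V)) q
  let χ := average μ ι (1 : H →* (ℝ →L[ℝ] ℝ)) u
  have hQ : Q ∈ sections EK ι (1 : H →* (V →L[ℝ] V)) :=
    average_mem_sections (μ := μ) hι contMDiff_const hq hq'
  have hχ : χ ∈ sections EK ι (1 : H →* (ℝ →L[ℝ] ℝ)) :=
    average_mem_sections (μ := μ) hι contMDiff_const u.contMDiff u.hasCompactSupport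
  have hQint := fun k => integrable_averageIntegrand (μ := μ) (ρ := (1 : H →* (V →L[ℝ] V)))
    hι contMDiff_const hq.continuous hq' k
  have hcoef : ∀ k h, u (k * ι h) • s.1 k = S k (q (k * ι h)) := by
    intro k h
    by_cases hk : k * ι h ∈ tsupport u
    · have h1 : S (k * ι h) (Ring.inverse (S (k * ι h)) (s.1 (k * ι h))) = s.1 (k * ι h) := by
        rw [← mul_apply_eq_comp, Ring.mul_inverse_cancel _ (hu hk)]; rfl
      have h2 := congrArg (ρ h) h1
      rw [hSeq k h, mul_apply_eq_comp, ← hSeq k h, s.2.2, hρinv, hρinv] at h2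
      simp only [q, map_smul]
      rw [s.2.2, h2]
    · simp only [q]
      rw [image_eq_zero_of_notMem_tsupport hk, zero_smul, zero_smul, map_zero]
  have hexp : ∀ k, χ k • s.1 k = S k (Q k) := by
    intro k
    refine (integral_smul_const _ _).symm.trans
      (Eq.trans ?_ ((S k).integral_comp_comm (hQint k)))
    exact integral_congr_ae (Filter.Eventually.of_forall fun h => hcoef k h)
  have hQ1 : Q 1 = 0 := by
    have := hexp 1
    rw [hs, smul_zero, hS1] at this
    exact this.symm
  have hχ1 : χ 1 ≠ 0 := by
    refine ne_of_gt ?_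
    refine Continuous.integral_pos_of_hasCompactSupport_nonneg_nonzero
      (continuous_averageIntegrand hι contMDiff_const u.contMDiff.continuous 1)
      (hasCompactSupport_averageIntegrand hι u.hasCompactSupport 1) (fun h => u.nonneg) (x := 1) ?_
    simp
  refine ⟨⟨χ, hχ⟩, hχ1, Module.finrank ℝ V, fun a =>
    ⟨fun k => b.coord a (Q k), ?_, fun k h => congrArg (b.coord a) (hQ.2 k h)⟩,
    fun a => σ (b a), fun a => by simp [hQ1], ?_⟩
  · exact (LinearMap.toContinuousLinearMap (b.coord a)).contMDiff.comp hQ.1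
  · refine Subtype.ext (funext fun k => ?_)
    refine (hexp k).trans ?_
    rw [hSsum]
    simp [mulSection]

end Frame

section Connection

variable {EK K EH H V : Type*}
  [NormedAddCommGroup EK] [NormedSpace ℝ EK]
  [TopologicalSpace K] [ChartedSpace EK K] [Group K] [LieGroup 𝓘(ℝ, EK) ∞ K]
  [NormedAddCommGroup EH] [NormedSpace ℝ EH]
  [TopologicalSpace H] [ChartedSpace EH H] [Group H]
  [NormedAddCommGroup V] [NormedSpace ℝ V]
  {ι : H →* K} {ρ : H →* (V →L[ℝ] V)}

omit [TopologicalSpace H] in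
theorem rep_apply_inv_apply (ρ : H →* (V →L[ℝ] V)) (h : H) (v : V) : ρ h (ρ h⁻¹ v) = v := by
  rw [← mul_apply_eq_comp, ← map_mul, mul_inv_cancel, map_one]; rfl

omit [TopologicalSpace H] in
theorem rep_inv_apply_apply (ρ : H →* (V →L[ℝ] V)) (h : H) (v : V) : ρ h⁻¹ (ρ h v) = v := by
  rw [← mul_apply_eq_comp, ← map_mul, inv_mul_cancel, map_one]; rfl

omit [TopologicalSpace H] in
/-- The fundamental derivative of a section is `H`-equivariant. -/
theorem fundDeriv_section_mul (s : sections EK ι ρ) (k : K) (h : H) (X : LieAlg EK K) :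
    fundDeriv s.1 (k * ι h) X = ρ h⁻¹ (fundDeriv s.1 k (Ad (ι h) X)) := by
  have hs := s.2.1
  have h1 : (fun x => s.1 (k * ι h * x)) = fun x => ρ h⁻¹ (s.1 (k * (ι h * x * (ι h)⁻¹))) := by
    funext x
    rw [← s.2.2]
    group
  have h2 : ContMDiff 𝓘(ℝ, EK) 𝓘(ℝ, V) ∞ fun x => s.1 (k * x) := hs.comp (contMDiff_leftMul k)
  rw [fundDeriv_eq_flatDeriv (mdifferentiableAt_of_contMDiff hs _),
    fundDeriv_eq_flatDeriv (mdifferentiableAt_of_contMDiff hs _), h1,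
    flatDeriv_clm_comp_apply (s := fun x => s.1 (k * (ι h * x * (ι h)⁻¹))) _
      (mdifferentiableAt_of_contMDiff (h2.comp (contMDiff_conj (ι h))) _),
    flatDeriv_comp_apply (g := fun x => s.1 (k * x)) (f := fun x => ι h * x * (ι h)⁻¹)
      (mdifferentiableAt_of_contMDiff h2 _)
      (mdifferentiableAt_of_contMDiff (contMDiff_conj (ι h)) _)]
  simp only [mul_one, mul_inv_cancel]
  rfl

/-- In vertical directions the fundamental derivative of a section is determined by
equivariance. -/
theorem fundDeriv_section_vertical [LieGroup 𝓘(ℝ, EH) ∞ H] (hι : ContMDiff 𝓘(ℝ, EH) 𝓘(ℝ, EK) ∞ ι)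
    (hρ : ContMDiff 𝓘(ℝ, EH) 𝓘(ℝ, V →L[ℝ] V) ∞ ρ) (s : sections EK ι ρ) (k : K)
    (Y : LieAlg EH H) :
    fundDeriv s.1 k (tangentHom (EB := EK) ι Y) = -(tangentRep ρ Y (s.1 k)) := by
  have hs : ContMDiff 𝓘(ℝ, EK) 𝓘(ℝ, V) ∞ fun x => s.1 (k * x) := s.2.1.comp (contMDiff_leftMul k)
  -- differentiate the constant function `h ↦ ρ(h) s(k h)`
  have h1 : (fun h => ρ h (s.1 (k * ι h))) = fun _ => s.1 k := by
    funext h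
    rw [s.2.2, rep_apply_inv_apply]
  have h2 := flatDeriv_bilin (.id ℝ (V →L[ℝ] V)) (mdifferentiableAt_of_contMDiff hρ 1)
    (mdifferentiableAt_of_contMDiff (hs.comp hι) 1) (toModel Y)
  simp only [ContinuousLinearMap.id_apply, Function.comp_apply, h1, map_one, mul_one] at h2
  rw [flatDeriv_const] at h2
  have h3 : fundDeriv (fun h => s.1 (k * ι h)) 1 Y = fundDeriv s.1 k (tangentHom (EB := EK) ι Y) := by
    have := fundDeriv_comp_hom (s := fun x => s.1 (k * x)) hι
      (mdifferentiableAt_of_contMDiff hs (ι 1)) Y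
    rw [this, fundDeriv_translate s.2.1, map_one, mul_one]
  rw [fundDeriv_one (s := fun h => s.1 (k * ι h)) (hs.comp hι)] at h3
  rw [← h3]
  exact (neg_eq_of_add_eq_zero_right h2.symm).symm

/-- The connection `D^𝔨 + Φ`. -/
def connectionOf [LieGroup 𝓘(ℝ, EH) ∞ H] (hι : ContMDiff 𝓘(ℝ, EH) 𝓘(ℝ, EK) ∞ ι)
    (hρ : ContMDiff 𝓘(ℝ, EH) 𝓘(ℝ, V →L[ℝ] V) ∞ ρ) (Φ : LieAlg EK K →ₗ[ℝ] (V →L[ℝ] V))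
    (hΦ : IsEquivariantMap ι ρ Φ) (hΦ' : ∀ Y, Φ (tangentHom ι Y) = tangentRep (EA := EH) ρ Y) :
    LinearConnection EK EH ι ρ where
  toLinearMap :=
    { toFun := fun s => ⟨fun k => fundDeriv s.1 k +
          (ContinuousLinearMap.apply ℝ V (s.1 k) : (V →L[ℝ] V) →ₗ[ℝ] V) ∘ₗ Φ,
        fun X => (contMDiff_fundDeriv s.2.1 X).add ((Φ X).contMDiff.comp s.2.1),
        fun k h X => by
          change fundDeriv s.1 (k * ι h) X + Φ X (s.1 (k * ι h)) =
            ρ h⁻¹ (fundDeriv s.1 k (Ad (ι h) X) + Φ (Ad (ι h) X) (s.1 k))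
          rw [fundDeriv_section_mul, map_add, hΦ h X, s.2.2, mul_apply_eq_comp, mul_apply_eq_comp,
            rep_inv_apply_apply],
        fun k X hX => by
          obtain ⟨Y, rfl⟩ := hX
          change fundDeriv s.1 k (tangentHom (EB := EK) ι Y) + Φ (tangentHom ι Y) (s.1 k) = 0
          rw [fundDeriv_section_vertical hι hρ, hΦ', neg_add_cancel]⟩
      map_add' := fun s t => by
        refine Subtype.ext (funext fun k => LinearMap.ext fun X => ?_)
        change fundDeriv (s.1 + t.1) k X + Φ X (s.1 k + t.1 k) =
          (fundDeriv s.1 k X + Φ X (s.1 k)) + (fundDeriv t.1 k X + Φ X (t.1 k))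
        rw [fundDeriv_add s.2.1 t.2.1, map_add]
        abel
      map_smul' := fun c s => by
        refine Subtype.ext (funext fun k => LinearMap.ext fun X => ?_)
        change fundDeriv (fun x => (c • .id ℝ V : V →L[ℝ] V) (s.1 x)) k X + Φ X (c • s.1 k) =
          c • (fundDeriv s.1 k X + Φ X (s.1 k))
        rw [fundDeriv_clm_comp s.2.1, map_smul, smul_add]
        rfl }
  leibniz f s k X := by
    change fundDeriv (fun x => f.1 x • s.1 x) k X + Φ X (f.1 k • s.1 k) =
      fundDeriv f.1 k X • s.1 k + f.1 k • (fundDeriv s.1 k X + Φ X (s.1 k))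
    rw [fundDeriv_smul f.2.1 s.2.1, map_smul, smul_add, add_assoc]

theorem connectionOf_isInvariant [LieGroup 𝓘(ℝ, EH) ∞ H]
    (hι : ContMDiff 𝓘(ℝ, EH) 𝓘(ℝ, EK) ∞ ι)
    (hρ : ContMDiff 𝓘(ℝ, EH) 𝓘(ℝ, V →L[ℝ] V) ∞ ρ) (Φ : LieAlg EK K →ₗ[ℝ] (V →L[ℝ] V))
    (hΦ : IsEquivariantMap ι ρ Φ) (hΦ' : ∀ Y, Φ (tangentHom ι Y) = tangentRep (EA := EH) ρ Y) :
    (connectionOf hι hρ Φ hΦ hΦ').IsInvariant := by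
  intro g s
  refine Subtype.ext (funext fun k => LinearMap.ext fun X => ?_)
  change fundDeriv (fun x => s.1 (g⁻¹ * x)) k X + Φ X (s.1 (g⁻¹ * k)) =
    fundDeriv s.1 (g⁻¹ * k) X + Φ X (s.1 (g⁻¹ * k))
  rw [fundDeriv_translate s.2.1]

omit [LieGroup 𝓘(ℝ, EK) ∞ K] in
theorem LinearConnection.ext_eval {D D' : LinearConnection EK EH ι ρ}
    (h : ∀ s k X, D.eval s k X = D'.eval s k X) : D = D' := by
  obtain ⟨L, hL⟩ := D
  obtain ⟨L', hL'⟩ := D'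
  have : L = L' := LinearMap.ext fun s =>
    Subtype.ext (funext fun k => LinearMap.ext fun X => h s k X)
  subst this
  rfl

omit [LieGroup 𝓘(ℝ, EK) ∞ K] [TopologicalSpace H] in
theorem fundDeriv_mulSection (f : baseFunctions EK ι) (s : sections EK ι ρ) (k : K)
    (X : LieAlg EK K) : fundDeriv (mulSection f s).1 k X =
      fundDeriv f.1 k X • s.1 k + f.1 k • fundDeriv s.1 k X :=
  fundDeriv_smul f.2.1 s.2.1 k X

/-- The difference `∇s - D^𝔨 s` at the base point, as a function of the section. -/
def differenceAt (D : LinearConnection EK EH ι ρ) (X : LieAlg EK K) : sections EK ι ρ →ₗ[ℝ] V where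
  toFun s := D.eval s 1 X - fundDeriv s.1 1 X
  map_add' s t := by
    have h1 : D.eval (s + t) 1 X = D.eval s 1 X + D.eval t 1 X := by
      simp only [LinearConnection.eval, map_add]; rfl
    have h2 : fundDeriv (s + t).1 1 X = fundDeriv s.1 1 X + fundDeriv t.1 1 X :=
      fundDeriv_add s.2.1 t.2.1 1 X
    rw [h1, h2]; abel
  map_smul' c s := by
    have h1 : D.eval (c • s) 1 X = c • D.eval s 1 X := by
      simp only [LinearConnection.eval, map_smul]; rfl
    have h2 : fundDeriv (c • s).1 1 X = c • fundDeriv s.1 1 X :=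
      fundDeriv_clm_comp s.2.1 (c • .id ℝ V : V →L[ℝ] V) 1 X
    rw [h1, h2, smul_sub, RingHom.id_apply]

omit [LieGroup 𝓘(ℝ, EK) ∞ K] in
theorem differenceAt_mulSection (D : LinearConnection EK EH ι ρ) (X : LieAlg EK K)
    (f : baseFunctions EK ι) (s : sections EK ι ρ) :
    differenceAt D X (mulSection f s) = f.1 1 • differenceAt D X s := by
  change (D.toLinearMap (mulSection f s)).1 1 X - fundDeriv (mulSection f s).1 1 X =
    f.1 1 • ((D.toLinearMap s).1 1 X - fundDeriv s.1 1 X)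
  rw [D.leibniz, fundDeriv_mulSection, smul_sub]
  abel

section FiniteDim

variable [FiniteDimensional ℝ EK] [T2Space K] [FiniteDimensional ℝ EH] [LieGroup 𝓘(ℝ, EH) ∞ H]
  [FiniteDimensional ℝ V]

/-- The difference of a connection and the fundamental derivative is tensorial. -/
theorem differenceAt_eq_zero (hι : IsClosedLieSubgroup EH EK ι)
    (hρ : ContMDiff 𝓘(ℝ, EH) 𝓘(ℝ, V →L[ℝ] V) ∞ ρ) (D : LinearConnection EK EH ι ρ)
    (X : LieAlg EK K) {s : sections EK ι ρ} (hs : s.1 1 = 0) : differenceAt D X s = 0 := by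
  obtain ⟨χ, hχ, n, f, t, hf, h⟩ := exists_cutoff_expansion hι hρ s hs
  have := congrArg (differenceAt D X) h
  simp only [map_sum, differenceAt_mulSection, hf, zero_smul, Finset.sum_const_zero] at this
  exact (smul_eq_zero.1 this).resolve_left hχ

/-- Every invariant connection is of the form `D^𝔨 + Φ`. -/
theorem LinearConnection.IsInvariant.exists_eval_eq (hι : IsClosedLieSubgroup EH EK ι)
    (hρ : ContMDiff 𝓘(ℝ, EH) 𝓘(ℝ, V →L[ℝ] V) ∞ ρ) {D : LinearConnection EK EH ι ρ}
    (hD : D.IsInvariant) : ∃ Φ : LieAlg EK K →ₗ[ℝ] (V →L[ℝ] V),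
      IsEquivariantMap ι ρ Φ ∧ (∀ Y, Φ (tangentHom ι Y) = tangentRep (EA := EH) ρ Y) ∧
        ∀ s k X, D.eval s k X = fundDeriv s.1 k X + Φ X (s.1 k) := by
  obtain ⟨σ, hσ⟩ := exists_linear_section (EK := EK) hι hρ
  let Φ : LieAlg EK K →ₗ[ℝ] (V →L[ℝ] V) :=
    { toFun := fun X => LinearMap.toContinuousLinearMap (differenceAt D X ∘ₗ σ)
      map_add' := fun X Y => by
        ext v
        change D.eval (σ v) 1 (X + Y) - fundDeriv (σ v).1 1 (X + Y) =
          (D.eval (σ v) 1 X - fundDeriv (σ v).1 1 X) + (D.eval (σ v) 1 Y - fundDeriv (σ v).1 1 Y)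
        simp only [LinearConnection.eval, map_add]
        abel
      map_smul' := fun c X => by
        ext v
        change D.eval (σ v) 1 (c • X) - fundDeriv (σ v).1 1 (c • X) =
          c • (D.eval (σ v) 1 X - fundDeriv (σ v).1 1 X)
        simp only [LinearConnection.eval, map_smul, smul_sub] }
  have hΦ1 : ∀ X (s : sections EK ι ρ), Φ X (s.1 1) = D.eval s 1 X - fundDeriv s.1 1 X := by
    intro X s
    have h0 : differenceAt D X (s - σ (s.1 1)) = 0 :=
      differenceAt_eq_zero hι hρ D X (sub_eq_zero.2 (hσ (s.1 1)).symm)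
    rw [map_sub, sub_eq_zero] at h0
    exact h0.symm
  -- by invariance the formula at the base point holds everywhere
  have hΦ : ∀ s k X, D.eval s k X = fundDeriv s.1 k X + Φ X (s.1 k) := by
    intro s k X
    have h1 := hΦ1 X (translateSection k⁻¹ s)
    have h2 : D.eval (translateSection k⁻¹ s) 1 X = D.eval s k X := by
      change (D.toLinearMap (translateSection k⁻¹ s)).1 1 X = _
      rw [hD]
      change (D.toLinearMap s).1 ((k⁻¹)⁻¹ * 1) X = _
      rw [inv_inv, mul_one]
      rfl
    have h3 : fundDeriv (translateSection k⁻¹ s).1 1 X = fundDeriv s.1 k X := by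
      change fundDeriv (fun x => s.1 ((k⁻¹)⁻¹ * x)) 1 X = _
      rw [fundDeriv_translate s.2.1, inv_inv, mul_one]
    have h4 : (translateSection k⁻¹ s).1 1 = s.1 k := by
      change s.1 ((k⁻¹)⁻¹ * 1) = _
      rw [inv_inv, mul_one]
    rw [h2, h3, h4] at h1
    rw [h1, add_sub_cancel]
  refine ⟨Φ, fun h X => ?_, fun Y => ?_, hΦ⟩
  · ext v
    have h1 : D.eval (σ v) (1 * ι h) X = ρ h⁻¹ (D.eval (σ v) 1 (Ad (ι h) X)) :=
      (D.toLinearMap (σ v)).2.2.1 1 h X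
    rw [hΦ, hΦ, fundDeriv_section_mul, map_add, add_right_inj, (σ v).2.2, hσ] at h1
    rw [mul_apply_eq_comp, mul_apply_eq_comp, h1, rep_apply_inv_apply]
  · ext v
    have h1 : D.eval (σ v) 1 (tangentHom ι Y) = 0 := (D.toLinearMap (σ v)).2.2.2 1 _ ⟨Y, rfl⟩
    rw [hΦ, fundDeriv_section_vertical hι.contMDiff hρ, hσ] at h1
    exact neg_add_eq_zero.1 h1 |>.symm

end FiniteDim

end Connection

/-! ### Homogeneous bundles of a parabolic geometry -/

section Extension

variable {EG G EP P EK K EH H V : Type*}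
  [NormedAddCommGroup EG] [NormedSpace ℝ EG]
  [TopologicalSpace G] [ChartedSpace EG G] [Group G]
  [NormedAddCommGroup EP] [NormedSpace ℝ EP]
  [TopologicalSpace P] [ChartedSpace EP P] [Group P] [LieGroup 𝓘(ℝ, EP) ∞ P]
  [NormedAddCommGroup EK] [NormedSpace ℝ EK]
  [TopologicalSpace K] [ChartedSpace EK K] [Group K]
  [NormedAddCommGroup EH] [NormedSpace ℝ EH]
  [TopologicalSpace H] [ChartedSpace EH H] [Group H] [LieGroup 𝓘(ℝ, EH) ∞ H]
  [NormedAddCommGroup V] [NormedSpace ℝ V]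
  {ι : H →* K} {j : P →* G} {i : H →* P} {α : LieAlg EK K →ₗ[ℝ] LieAlg EG G}
  {lam : P →* (V →L[ℝ] V)}

theorem tangentRep_comp (hlam : ContMDiff 𝓘(ℝ, EP) 𝓘(ℝ, V →L[ℝ] V) ∞ lam)
    (hi : ContMDiff 𝓘(ℝ, EH) 𝓘(ℝ, EP) ∞ i) (Y : LieAlg EH H) :
    tangentRep (lam.comp i) Y = tangentRep lam (tangentHom (EB := EP) i Y) := by
  have h := fundDeriv_comp_hom hi (mdifferentiableAt_of_contMDiff hlam (i 1)) Y
  rw [fundDeriv_rep hlam, map_one, map_one, one_mul,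
    fundDeriv_one (s := fun h => lam (i h)) (hlam.comp hi)] at h
  exact h

/-- For an extension, the condition on `Φ|_𝔥` says that `Φ ∘ dι` is the derivative of the
representation `λ ∘ i` of `H`. -/
theorem restrictsToRep_iff (hj : Function.Injective (tangentHom (EA := EP) (EB := EG) j))
    (hα : IsExtension EP EH ι j i α)
    (hlam : ContMDiff 𝓘(ℝ, EP) 𝓘(ℝ, V →L[ℝ] V) ∞ lam) (Φ : LieAlg EK K →ₗ[ℝ] (V →L[ℝ] V)) :
    RestrictsToRep EH EP ι j α lam Φ ↔
      ∀ Y : LieAlg EH H, Φ (tangentHom ι Y) = tangentRep (lam.comp i) Y := by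
  constructor
  · intro h Y
    exact (h (tangentHom ι Y) ⟨Y, rfl⟩ (tangentHom i Y) (hα.restrict Y).symm).trans
      (tangentRep_comp hlam hα.contMDiff Y).symm
  · rintro h _ ⟨Y, rfl⟩ Z hZ
    have : Z = tangentHom i Y := hj (hZ.trans (hα.restrict Y))
    rw [this, ← tangentRep_comp hlam hα.contMDiff]
    exact h Y

end Extension

section Filtration

variable {EK K V : Type*}
  [NormedAddCommGroup EK] [NormedSpace ℝ EK]
  [TopologicalSpace K] [ChartedSpace EK K] [Group K]
  [NormedAddCommGroup V] [NormedSpace ℝ V] [FiniteDimensional ℝ V]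

theorem fundDeriv_mem {s : K → V} (hs : ContMDiff 𝓘(ℝ, EK) 𝓘(ℝ, V) ∞ s) {S : Submodule ℝ V}
    (hS : ∀ k, s k ∈ S) (k : K) (X : LieAlg EK K) : fundDeriv s k X ∈ S := by
  obtain ⟨p, hp⟩ := exists_clm_fixed_iff S
  rw [hp, ← fundDeriv_clm_comp hs]
  simp only [(hp _).1 (hS _)]

end Filtration

end HomogeneousConnection

end

open HomogeneousConnection in
theorem mainTheorem1
    {EK K EH H EG G EP P V : Type*}
    -- the Lie group `K`
    [NormedAddCommGroup EK] [NormedSpace ℝ EK] [FiniteDimensional ℝ EK]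
    [TopologicalSpace K] [T2Space K] [ChartedSpace EK K] [Group K] [LieGroup 𝓘(ℝ, EK) ∞ K]
    -- the Lie group `H`
    [NormedAddCommGroup EH] [NormedSpace ℝ EH] [FiniteDimensional ℝ EH]
    [TopologicalSpace H] [ChartedSpace EH H] [Group H] [LieGroup 𝓘(ℝ, EH) ∞ H]
    -- the semisimple Lie group `G`
    [NormedAddCommGroup EG] [NormedSpace ℝ EG] [FiniteDimensional ℝ EG]
    [TopologicalSpace G] [T2Space G] [ChartedSpace EG G] [Group G] [LieGroup 𝓘(ℝ, EG) ∞ G]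
    [LieAlgebra.IsSemisimple ℝ (LieAlg EG G)]
    -- the Lie group `P`
    [NormedAddCommGroup EP] [NormedSpace ℝ EP] [FiniteDimensional ℝ EP]
    [TopologicalSpace P] [ChartedSpace EP P] [Group P] [LieGroup 𝓘(ℝ, EP) ∞ P]
    -- the finite-dimensional representation space `V`
    [NormedAddCommGroup V] [NormedSpace ℝ V] [FiniteDimensional ℝ V]
    -- `H` is a closed subgroup of `K`, and `P` is a parabolic subgroup of `G`
    (ι : H →* K) (hι : IsClosedLieSubgroup EH EK ι)
    (j : P →* G) (E : LieAlg EP P) (hP : IsParabolic (EG := EG) EP j E)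
    -- `(α, i)` is an extension of `(K, H)` to `(G, P)`
    (i : H →* P) (α : LieAlg EK K →ₗ[ℝ] LieAlg EG G) (hα : IsExtension EP EH ι j i α)
    -- `lam` is a representation of `P` on `V`
    (lam : P →* (V →L[ℝ] V)) (hlam : ContMDiff 𝓘(ℝ, EP) 𝓘(ℝ, V →L[ℝ] V) ∞ lam) :
    ∃ nabla :
        {Φ : LieAlg EK K →ₗ[ℝ] (V →L[ℝ] V) //
          IsEquivariantMap ι (lam.comp i) Φ ∧ RestrictsToRep EH EP ι j α lam Φ} ≃
        {D : LinearConnection EK EH ι (lam.comp i) // D.IsInvariant},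
      -- the bijection is `Φ ↦ D^𝔨 + Φ`
      (∀ Φ s k X, (nabla Φ).1.eval s k X = fundDeriv s.1 k X + Φ.1 X (s.1 k)) ∧
      -- preservation of the filtration by eigenvalues of the grading element
      ((⨆ c : ℝ, Module.End.eigenspace (tangentRep lam E : V →ₗ[ℝ] V) c = ⊤) →
        ∀ Φ, (nabla Φ).1.PreservesFiltration
            (eigenFiltration (tangentRep lam E : V →ₗ[ℝ] V)) ↔
          ∀ X, Φ.1 X ∈ eigenFiltration
            (commutatorEnd (tangentRep lam E)) 0) ∧
      -- the difference of two invariant connections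
      (∀ D D' : LinearConnection EK EH ι (lam.comp i), D.IsInvariant → D'.IsInvariant →
        ∃! ψ : LieAlg EK K →ₗ[ℝ] (V →L[ℝ] V),
          IsEquivariantMap ι (lam.comp i) ψ ∧ (∀ Y ∈ subAlg EH EK ι, ψ Y = 0) ∧
          ∀ s k X, D.eval s k X - D'.eval s k X = ψ X (s.1 k)) ∧
      -- invariant parallel sections
      (∀ Φ s, (nabla Φ).1.IsParallel s → IsInvariantSection s →
        ∀ Y k, Φ.1 Y (s.1 k) = 0) ∧
      (ConnectedSpace K → ∀ Φ s, (nabla Φ).1.IsParallel s →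
        (IsInvariantSection s ↔ ∀ Y k, Φ.1 Y (s.1 k) = 0)) := by
  have hj := hP.isClosedLieSubgroup.injective_tangentHom
  have hρ : ContMDiff 𝓘(ℝ, EH) 𝓘(ℝ, V →L[ℝ] V) ∞ (lam.comp i) := hlam.comp hα.contMDiff
  have hres := restrictsToRep_iff hj hα hlam
  have hval : ∀ v, ∃ s : sections EK ι (lam.comp i), s.1 1 = v := fun v =>
    (exists_section_eq hι hρ ⊤ (fun _ _ _ => trivial) (v := v) trivial).imp fun s hs => hs.1
  let F : {Φ : LieAlg EK K →ₗ[ℝ] (V →L[ℝ] V) //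
      IsEquivariantMap ι (lam.comp i) Φ ∧ RestrictsToRep EH EP ι j α lam Φ} →
      {D : LinearConnection EK EH ι (lam.comp i) // D.IsInvariant} := fun Φ =>
    ⟨connectionOf hι.contMDiff hρ Φ.1 Φ.2.1 ((hres Φ.1).1 Φ.2.2),
      connectionOf_isInvariant _ _ _ _ _⟩
  have hF : ∀ Φ s k X, (F Φ).1.eval s k X = fundDeriv s.1 k X + Φ.1 X (s.1 k) :=
    fun _ _ _ _ => rfl
  have hbij : Function.Bijective F := by
    constructor
    · intro Φ Φ' h
      refine Subtype.ext (LinearMap.ext fun X => ContinuousLinearMap.ext fun v => ?_)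
      obtain ⟨s, rfl⟩ := hval v
      have h1 := hF Φ s 1 X
      rw [h, hF Φ' s 1 X, add_right_inj] at h1
      exact h1.symm
    · intro D
      obtain ⟨Φ, h1, h2, h3⟩ := D.2.exists_eval_eq hι hρ
      refine ⟨⟨Φ, h1, (hres Φ).2 h2⟩, Subtype.ext (LinearConnection.ext_eval fun s k X => ?_)⟩
      rw [hF, h3]
  have hparallel : ∀ Φ s, (F Φ).1.IsParallel s → ∀ k X,
      fundDeriv s.1 k X + Φ.1 X (s.1 k) = 0 := fun Φ s hs k X =>
    congrArg (fun A : oneForms EK EH ι (lam.comp i) => A.1 k X) hs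
  -- an invariant section is a constant function on `K`, with vanishing fundamental derivative
  have hinvariant : ∀ Φ s, (F Φ).1.IsParallel s → IsInvariantSection s →
      ∀ Y k, Φ.1 Y (s.1 k) = 0 := by
    intro Φ s hs hinv Y k
    have hconst : s.1 = fun _ => s.1 1 := funext fun g => by
      have h : s.1 (g⁻¹ * g) = s.1 g :=
        congrArg (fun t : sections EK ι (lam.comp i) => t.1 g) (hinv g)
      rw [← h, inv_mul_cancel]
    have h0 : fundDeriv s.1 k Y = 0 := by
      rw [hconst]
      exact fundDeriv_const _ k Y
    have h1 := hparallel Φ s hs k Y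
    rwa [h0, zero_add] at h1
  refine ⟨Equiv.ofBijective F hbij, hF, fun hT Φ => ?_, fun D D' hD hD' => ?_,
    hinvariant, fun _ Φ s hs => ⟨hinvariant Φ s hs, fun h g => ?_⟩⟩
  · simp only [mem_eigenFiltration_commutatorEnd_iff hT]
    constructor
    · intro h X ℓ v hv
      obtain ⟨s, rfl, hs⟩ := exists_section_eq hι hρ _
        (fun h v hv => hP.rep_mem_eigenFiltration hlam hT (i h) ℓ v hv) hv
      have h1 := h ℓ s hs 1 X
      exact (Submodule.add_mem_iff_right _ (fundDeriv_mem s.2.1 hs 1 X)).1 h1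
    · intro h ℓ s hs k X
      exact Submodule.add_mem _ (fundDeriv_mem s.2.1 hs k X) (h X ℓ _ (hs k))
  · obtain ⟨Φ, h1, h2, h3⟩ := hD.exists_eval_eq hι hρ
    obtain ⟨Φ', h1', h2', h3'⟩ := hD'.exists_eval_eq hι hρ
    refine ⟨Φ - Φ', ⟨fun h X => ?_, ?_, fun s k X => ?_⟩, fun ψ hψ => ?_⟩
    · simp only [LinearMap.sub_apply, h1 h X, h1' h X, mul_sub, sub_mul]
    · rintro _ ⟨Y, rfl⟩
      exact sub_eq_zero.2 ((h2 Y).trans (h2' Y).symm)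
    · rw [h3, h3', add_sub_add_left_eq_sub]
      rfl
    · refine LinearMap.ext fun X => ContinuousLinearMap.ext fun v => ?_
      obtain ⟨s, rfl⟩ := hval v
      rw [← hψ.2.2 s 1 X, h3, h3', add_sub_add_left_eq_sub]
      rfl
  · refine Subtype.ext (funext fun k =>
      eq_of_fundDeriv_eq_zero s.2.1 (fun k X => ?_) (g⁻¹ * k) k)
    have h1 := hparallel Φ s hs k X
    rwa [h X k, add_zero] at h1
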